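/- Fix an optimal decompressor, i.e. a partial computable map $D$ from finite binary strings to finite binary strings such that for every partial computable map $D'$ from binary strings to binary strings there is a constant $c$ such that every string $x=D'(q')$ also has the form $x=D(q)$ with $|q|\le |q'|+c$. Let $C(x)=\min\{|q| : D(q)=x\}$ be the corresponding (plain) Kolmogorov complexity. The effective Hausdorff dimension of an infinite bit sequence $X=x_1x_2x_3\ldots$ is $\liminf_{n\to\infty} C(x_1\ldots x_n)/n$. Write $H(p)=-p\log_2 p-(1-p)\log_2(1-p)$ and $N(p,\tau)=p(1-\tau)+(1-p)\tau$. Theorem. Let $p,\tau\in(0,1/2)$ be reals, $\alpha=H(p)$ and $\beta=H(N(p,\tau))$. Let $X$ be an infinite bit sequence of effective Hausdorff dimension at least $\alpha$. Let $N_\tau(X)$ be the random sequence obtained from $X$ by changing the bit at each position with probability $\tau$, independently for different positions. Then with probability $1$ the effective Hausdorff dimension of $N_\tau(X)$ is at least $\beta$. -/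

import Mathlib

open MeasureTheory ProbabilityTheory Filter

/-- A decompressor (programming language): a partial map from programs to outputs,
both of them finite binary strings. -/
abbrev Decompressor : Type := List Bool →. List Bool

/-- The decompressor `D` is optimal: it is partial computable, and for every other partial
computable decompressor `D'` there is a constant `c` such that whatever `D'` produces from a
program of length `l`, `D` produces from some program of length at most `l + c`. -/
def Decompressor.IsOptimal (D : Decompressor) : Prop :=
  Partrec D ∧ ∀ D' : Decompressor, Partrec D' →
    ∃ c : ℕ, ∀ p x : List Bool, x ∈ D' p → ∃ q : List Bool, x ∈ D q ∧ q.length ≤ p.length + c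

/-- Plain Kolmogorov complexity with respect to the decompressor `D`: the minimal length of a
program for `x`. (For an optimal `D` every `x` has a program, see `IsOptimal.exists_program`.) -/
noncomputable def plainComplexity (D : Decompressor) (x : List Bool) : ℕ :=
  sInf {l : ℕ | ∃ p : List Bool, x ∈ D p ∧ p.length = l}

/-- The string formed by the first `n` bits of the infinite sequence `X`. -/
def firstBits (X : ℕ → Bool) (n : ℕ) : List Bool :=
  List.ofFn fun i : Fin n => X i

/-- Effective Hausdorff dimension of `X`: the lower limit of the complexity of the first `n` bits
divided by `n` (taken in the extended reals, where every lower limit exists). -/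
noncomputable def effectiveDim (D : Decompressor) (X : ℕ → Bool) : EReal :=
  liminf (fun n : ℕ => (((plainComplexity D (firstBits X n) : ℝ) / (n : ℝ) : ℝ) : EReal)) atTop

/-- Shannon entropy in bits of a Bernoulli variable with parameter `p`,
`- p * log₂ p - (1 - p) * log₂ (1 - p)`. -/
noncomputable def shannonH (p : ℝ) : ℝ :=
  Real.binEntropy p / Real.log 2

/-- The probability that a bit is changed, if it is changed with probability `p` and then,
independently, with probability `τ`. -/
def noiseParam (p τ : ℝ) : ℝ :=
  p * (1 - τ) + (1 - p) * τ

/-- The sequence obtained from `X` by flipping exactly the bits at the positions marked by `E`. -/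
def flipBits (X E : ℕ → Bool) : ℕ → Bool :=
  fun i => xor (X i) (E i)

/-- The noise sequence `E` of `τ`-noise: the events `E i = true` ("the bit at position `i` is
changed") are independent and each of them has probability `τ`. -/
structure IsBitNoise {Ω : Type*} [MeasurableSpace Ω] (μ : Measure Ω) (τ : ℝ)
    (E : ℕ → Ω → Bool) : Prop where
  measurable : ∀ i, Measurable (E i)
  indep : iIndepFun E μ
  prob : ∀ i, μ {ω | E i ω = true} = ENNReal.ofReal τ

/-- With respect to an optimal decompressor every string has a program. -/
theorem Decompressor.IsOptimal.exists_program {D : Decompressor} (hD : D.IsOptimal)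
    (x : List Bool) : ∃ q : List Bool, x ∈ D q := by
  obtain ⟨c, hc⟩ := hD.2 (fun p => Part.some p) Partrec.some
  obtain ⟨q, hq, -⟩ := hc x x (Part.mem_some x)
  exact ⟨q, hq⟩

/-- Splits a program `1ⁿ 0 q` into `n` and `q`. -/
def splitProgram (l : List Bool) : ℕ × List Bool :=
  List.rec (0, []) (fun b t ih => bif b then (ih.1 + 1, ih.2) else (0, t)) l

theorem splitProgram_primrec : Primrec splitProgram := by
  have h : Primrec₂ fun (_ : List Bool) (r : Bool × List Bool × (ℕ × List Bool)) =>
      bif r.1 then (r.2.2.1 + 1, r.2.2.2) else (0, r.2.1) := by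
    have hr : Primrec fun a : List Bool × (Bool × List Bool × (ℕ × List Bool)) => a.2 :=
      Primrec.snd
    have h2 := Primrec.snd.comp hr
    have h22 := Primrec.snd.comp h2
    exact Primrec.cond (Primrec.fst.comp hr)
      (Primrec.pair (Primrec.succ.comp (Primrec.fst.comp h22)) (Primrec.snd.comp h22))
      (Primrec.pair (Primrec.const 0) (Primrec.fst.comp h2))
  exact Primrec.list_rec Primrec.id (Primrec.const (0, [])) h

theorem splitProgram_append (n : ℕ) (q : List Bool) :
    splitProgram (List.replicate n true ++ false :: q) = (n, q) := by
  induction n with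
  | zero => rfl
  | succ n ih =>
    have : splitProgram (true :: (List.replicate n true ++ false :: q)) =
      ((splitProgram (List.replicate n true ++ false :: q)).1 + 1,
        (splitProgram (List.replicate n true ++ false :: q)).2) := rfl
    rw [List.replicate_succ, List.cons_append, this, ih]

/-- Optimal decompressors exist. -/
theorem exists_isOptimal : ∃ D : Decompressor, D.IsOptimal := by
  refine ⟨fun l => ((Nat.Partrec.Code.eval (Denumerable.ofNat Nat.Partrec.Code (splitProgram l).1)
    (Encodable.encode (splitProgram l).2)).bind
      fun m => (Encodable.decode (α := List Bool) m : Part (List Bool))), ?_, ?_⟩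
  · refine Partrec.bind ?_ ?_
    · exact Nat.Partrec.Code.eval_part.comp
        ((Computable.ofNat _).comp (Computable.fst.comp splitProgram_primrec.to_comp))
        (Computable.encode.comp (Computable.snd.comp splitProgram_primrec.to_comp))
    · exact Computable.ofOption (Computable.decode.comp Computable.snd)
  · intro D' hD'
    obtain ⟨c, hc⟩ := Nat.Partrec.Code.exists_code.1 hD'
    refine ⟨Encodable.encode c + 1, fun p x hx =>
      ⟨List.replicate (Encodable.encode c) true ++ false :: p, ?_, ?_⟩⟩
    · simp only [splitProgram_append, Denumerable.ofNat_encode, hc, Encodable.encodek,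
        Part.coe_some, Part.bind_some, Part.mem_bind_iff, Part.mem_map_iff]
      exact ⟨_, ⟨x, hx, rfl⟩, by simp⟩
    · simp; omega

/-! The proof bounds the expected complexity of the noisy prefixes of `X` from below and then shows
that their complexity is concentrated.

Let `h` be the binary entropy, and let `1 / s` be the slope of the function `h(p) ↦ h(N(p, τ))` at
`h(p)`. By Mrs. Gerber's lemma this function is convex, so that `h(t) - s h(N(t, τ))` is largest
at `t = p` (`entropy_sub_le_gerberGap`). Through Gibbs' inequality this is equivalent to an
inequality about functions of one bit (`noise_one_bit`), which by Hölder's inequality tensorizes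
(`sum_exp_noiseMean_le`) to
`∑ x, exp (s E f(N_τ(x))) ≤ exp (n κ) * (∑ y, exp (f y)) ^ s`,
where `x` and `y` range over the strings of length `n` and `κ = h(p) - s h(N(p, τ))`.

For `f = - C log 2`, where `C` is the complexity, the last sum is at most `n + O(1)`. Hence at most
`exp (s m log 2 + n κ + O(log n))` strings `x` satisfy `E C(N_τ(x)) ≤ m` (`card_noiseMean_le`). For
a rational noise level these strings can be enumerated, so that each of them is determined by its
number in the enumeration. It follows that
`E C(N_τ(x)) ≥ n H(N(p, τ)) + (C(x) - n H(p)) / s - O(log n)`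
(`Decompressor.IsOptimal.exists_le_noiseMean`). This is at least `n (β - o(1))` for the prefixes
of `X`.

A change of one bit changes the complexity by `O(log n)`, so by a bounded difference inequality
(`noiseMean_exp_le`) and the Borel-Cantelli lemma the complexity of the noisy prefixes almost surely
falls below its expectation by at most `o(n)` (`Decompressor.IsOptimal.ae_noiseMean_sub_le`).
-/

open Asymptotics

/-! ### Mrs. Gerber's lemma for one bit -/

theorem hasDerivAt_entropySlope {x : ℝ} (h0 : 0 < x) (h1 : x < 1) :
    HasDerivAt (fun x => Real.log (1 - x) - Real.log x) (-1 / (x * (1 - x))) x := by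
  have h2 : (1 - x) ≠ 0 := by linarith
  have := (((hasDerivAt_id x).const_sub 1).log (by simpa using h2)).sub
    (Real.hasDerivAt_log h0.ne')
  refine this.congr_deriv ?_
  simp only [id]
  field_simp
  ring

theorem entropySlope_pos {x : ℝ} (h0 : 0 < x) (h1 : x < 1 / 2) :
    0 < Real.log (1 - x) - Real.log x :=
  sub_pos.2 (Real.log_lt_log h0 (by linarith))

theorem entropySlope_anti {x y : ℝ} (h0 : 0 < x) (hxy : x ≤ y) (h1 : y < 1) :
    Real.log (1 - y) - Real.log y ≤ Real.log (1 - x) - Real.log x :=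
  sub_le_sub (Real.log_le_log (by linarith) (by linarith)) (Real.log_le_log h0 hxy)

/-- The function `x (1 - x) h'(x)`, with `h` the binary entropy, is concave up to `1 / 2`: its
derivative is `(1 - 2 x) h'(x) - 1`, and both factors decrease and are nonnegative. -/
theorem concaveOn_mul_entropySlope :
    ConcaveOn ℝ (Set.Ioc (0 : ℝ) (1 / 2))
      fun x => x * (1 - x) * (Real.log (1 - x) - Real.log x) := by
  have hd : ∀ x ∈ Set.Ioo (0 : ℝ) 1, HasDerivAt
      (fun x : ℝ => x * (1 - x) * (Real.log (1 - x) - Real.log x))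
      ((1 - 2 * x) * (Real.log (1 - x) - Real.log x) - 1) x := by
    intro x hx
    have h1 : (1 - x) ≠ 0 := by linarith [hx.2]
    have h0 := hx.1.ne'
    refine ((((hasDerivAt_id x).mul ((hasDerivAt_id x).const_sub 1))).mul
      (hasDerivAt_entropySlope hx.1 hx.2)).congr_deriv ?_
    simp only [id, Pi.mul_apply]
    field_simp
    ring
  have hsub : ∀ x ∈ Set.Ioc (0 : ℝ) (1 / 2), x ∈ Set.Ioo (0 : ℝ) 1 :=
    fun x hx => ⟨hx.1, by linarith [hx.2]⟩
  refine AntitoneOn.concaveOn_of_deriv (convex_Ioc _ _)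
    (fun x hx => (hd x (hsub x hx)).continuousAt.continuousWithinAt) ?_ ?_
  · exact fun x hx => (hd x (hsub x (interior_subset hx))).differentiableAt.differentiableWithinAt
  · intro x hx y hy hxy
    rw [interior_Ioc] at hx hy
    rw [(hd x ⟨hx.1, by linarith [hx.2]⟩).deriv, (hd y ⟨hy.1, by linarith [hy.2]⟩).deriv]
    have := entropySlope_anti hx.1 hxy (by linarith [hy.2])
    have := entropySlope_pos hy.1 hy.2
    have := hx.2
    have : 0 ≤ 1 - 2 * x := by linarith
    gcongr

theorem noiseParam_eq (p τ : ℝ) : noiseParam p τ = (1 - 2 * τ) * p + τ := by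
  unfold noiseParam; ring

theorem noiseParam_mem {p τ : ℝ} (hp : p ∈ Set.Ioo (0 : ℝ) (1 / 2))
    (hτ : τ ∈ Set.Ioo (0 : ℝ) (1 / 2)) : noiseParam p τ ∈ Set.Ioo (0 : ℝ) (1 / 2) := by
  have h1 := hp.1; have h2 := hp.2; have h3 := hτ.1; have h4 := hτ.2
  rw [noiseParam_eq]
  constructor
  · have : 0 < (1 - 2 * τ) * p := mul_pos (by linarith) h1
    linarith
  · nlinarith

theorem noiseParam_mem_unit {p τ : ℝ} (hp : p ∈ Set.Ioo (0 : ℝ) 1)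
    (hτ : τ ∈ Set.Ioo (0 : ℝ) (1 / 2)) : noiseParam p τ ∈ Set.Ioo (0 : ℝ) 1 := by
  have h1 := hp.1; have h2 := hp.2; have h3 := hτ.1; have h4 := hτ.2
  rw [noiseParam_eq]
  constructor
  · have : 0 < (1 - 2 * τ) * p := mul_pos (by linarith) h1
    linarith
  · nlinarith

theorem HasDerivAt.comp_noiseParam {f : ℝ → ℝ} {f' t τ : ℝ}
    (hf : HasDerivAt f f' (noiseParam t τ)) :
    HasDerivAt (fun t => f (noiseParam t τ)) (f' * (1 - 2 * τ)) t := by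
  have : HasDerivAt (fun t => noiseParam t τ) (1 - 2 * τ) t := by
    simp only [noiseParam_eq]
    simpa using ((hasDerivAt_id t).const_mul (1 - 2 * τ)).add_const τ
  exact hf.comp t this

/-- The analytic core of Mrs. Gerber's lemma: the ratio of the slopes of the entropy before and
after the noise decreases. The sign of its derivative is given by
`concaveOn_mul_entropySlope`, as the noise moves `t` towards `1 / 2`. -/
theorem antitoneOn_entropySlope_ratio {τ : ℝ} (hτ : τ ∈ Set.Ioo (0 : ℝ) (1 / 2)) :
    AntitoneOn (fun t => (Real.log (1 - t) - Real.log t) /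
      (Real.log (1 - noiseParam t τ) - Real.log (noiseParam t τ))) (Set.Ioo (0 : ℝ) (1 / 2)) := by
  have hd : ∀ t ∈ Set.Ioo (0 : ℝ) (1 / 2), HasDerivAt
      (fun t => (Real.log (1 - t) - Real.log t) /
        (Real.log (1 - noiseParam t τ) - Real.log (noiseParam t τ)))
      ((-1 / (t * (1 - t)) * (Real.log (1 - noiseParam t τ) - Real.log (noiseParam t τ)) -
        (Real.log (1 - t) - Real.log t) *
          (-1 / (noiseParam t τ * (1 - noiseParam t τ)) * (1 - 2 * τ))) /
        (Real.log (1 - noiseParam t τ) - Real.log (noiseParam t τ)) ^ 2) t := by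
    intro t ht
    have hN := noiseParam_mem ht hτ
    exact (hasDerivAt_entropySlope ht.1 (by linarith [ht.2])).div
      (hasDerivAt_entropySlope hN.1 (by linarith [hN.2])).comp_noiseParam
      (entropySlope_pos hN.1 hN.2).ne'
  refine antitoneOn_of_deriv_nonpos (convex_Ioo _ _)
    (fun t ht => (hd t ht).continuousAt.continuousWithinAt)
    (fun t ht => (hd t (interior_subset ht)).differentiableAt.differentiableWithinAt) ?_
  intro t ht
  have ht := interior_subset ht
  rw [(hd t ht).deriv]
  refine div_nonpos_of_nonpos_of_nonneg ?_ (sq_nonneg _)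
  have hN := noiseParam_mem ht hτ
  have hc := concaveOn_mul_entropySlope.2 ⟨ht.1, ht.2.le⟩
    (show (1 / 2 : ℝ) ∈ Set.Ioc 0 (1 / 2) by norm_num) (show 0 ≤ 1 - 2 * τ by linarith [hτ.2])
    (show 0 ≤ 2 * τ by linarith [hτ.1]) (by ring)
  have e : (1 - 2 * τ) * t + 2 * τ * (1 / 2) = noiseParam t τ := by rw [noiseParam_eq]; ring
  simp only [smul_eq_mul, e] at hc
  norm_num at hc
  have a1 : 0 < t * (1 - t) := mul_pos ht.1 (by linarith [ht.2])
  have a2 : 0 < noiseParam t τ * (1 - noiseParam t τ) := mul_pos hN.1 (by linarith [hN.2])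
  generalize Real.log (1 - t) - Real.log t = u at *
  generalize Real.log (1 - noiseParam t τ) - Real.log (noiseParam t τ) = v at *
  generalize noiseParam t τ * (1 - noiseParam t τ) = b at *
  generalize t * (1 - t) = a at *
  rw [show -1 / a * v - u * (-1 / b * (1 - 2 * τ)) = ((1 - 2 * τ) * (a * u) - b * v) / (a * b) by
    field_simp; ring]
  exact div_nonpos_of_nonpos_of_nonneg (by linarith) (by positivity)

/-- The reciprocal of the slope at `H(p)` of Mrs. Gerber's function `H(p) ↦ H(N(p, τ))`. -/
noncomputable def gerberSlope (p τ : ℝ) : ℝ :=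
  (Real.log (1 - p) - Real.log p) /
    ((1 - 2 * τ) * (Real.log (1 - noiseParam p τ) - Real.log (noiseParam p τ)))

theorem gerberSlope_pos {p τ : ℝ} (hp : p ∈ Set.Ioo (0 : ℝ) (1 / 2))
    (hτ : τ ∈ Set.Ioo (0 : ℝ) (1 / 2)) : 0 < gerberSlope p τ := by
  have hN := noiseParam_mem hp hτ
  exact div_pos (entropySlope_pos hp.1 hp.2)
    (mul_pos (by linarith [hτ.2]) (entropySlope_pos hN.1 hN.2))

/-- The value at `t = p`, which is the largest one, of `h(t) - s h(N(t, τ))`, where `s` is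
`gerberSlope p τ`. -/
noncomputable def gerberGap (p τ : ℝ) : ℝ :=
  Real.binEntropy p - gerberSlope p τ * Real.binEntropy (noiseParam p τ)

/-- Mrs. Gerber's lemma for one bit, in the form of a tangent line. -/
theorem entropy_sub_le_gerberGap {p τ : ℝ} (hp : p ∈ Set.Ioo (0 : ℝ) (1 / 2))
    (hτ : τ ∈ Set.Ioo (0 : ℝ) (1 / 2)) {t : ℝ} (ht : t ∈ Set.Ioo (0 : ℝ) 1) :
    Real.binEntropy t - gerberSlope p τ * Real.binEntropy (noiseParam t τ) ≤ gerberGap p τ := by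
  wlog h : t ≤ 1 / 2 generalizing t
  · have := this (t := 1 - t) ⟨by linarith [ht.2], by linarith [ht.1]⟩ (by linarith)
    rwa [Real.binEntropy_one_sub, show noiseParam (1 - t) τ = 1 - noiseParam t τ by
      unfold noiseParam; ring, Real.binEntropy_one_sub] at this
  set s := gerberSlope p τ with hs
  have hd : ∀ t ∈ Set.Ioo (0 : ℝ) 1, HasDerivAt
      (fun t => Real.binEntropy t - s * Real.binEntropy (noiseParam t τ))
      ((Real.log (1 - t) - Real.log t) - s *
        ((Real.log (1 - noiseParam t τ) - Real.log (noiseParam t τ)) * (1 - 2 * τ))) t := by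
    intro t ht
    have hN := noiseParam_mem_unit ht hτ
    exact (Real.hasDerivAt_binEntropy ht.1.ne' ht.2.ne).sub
      ((Real.hasDerivAt_binEntropy hN.1.ne' hN.2.ne).comp_noiseParam.const_mul s)
  have hslope : ∀ t, s * ((Real.log (1 - noiseParam t τ) - Real.log (noiseParam t τ)) *
      (1 - 2 * τ)) = (Real.log (1 - p) - Real.log p) /
        (Real.log (1 - noiseParam p τ) - Real.log (noiseParam p τ)) *
          (Real.log (1 - noiseParam t τ) - Real.log (noiseParam t τ)) := by
    intro t
    have : 1 - 2 * τ ≠ 0 := by linarith [hτ.2]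
    have hN := noiseParam_mem hp hτ
    have := (entropySlope_pos hN.1 hN.2).ne'
    rw [hs, gerberSlope]
    field_simp
  rcases le_total t p with htp | htp
  · have hm : MonotoneOn (fun t => Real.binEntropy t - s * Real.binEntropy (noiseParam t τ))
        (Set.Icc t p) := by
      have hsub : ∀ u ∈ Set.Icc t p, u ∈ Set.Ioo (0 : ℝ) 1 :=
        fun u hu => ⟨ht.1.trans_le hu.1, by linarith [hu.2, hp.2]⟩
      refine monotoneOn_of_deriv_nonneg (convex_Icc _ _)
        (fun u hu => (hd u (hsub u hu)).continuousAt.continuousWithinAt)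
        (fun u hu => (hd u (hsub u (interior_subset hu))).differentiableAt.differentiableWithinAt)
        ?_
      intro u hu
      have hu := interior_subset hu
      have hu' : u ∈ Set.Ioo (0 : ℝ) (1 / 2) := ⟨(hsub u hu).1, hu.2.trans_lt hp.2⟩
      have hN := noiseParam_mem hu' hτ
      rw [(hd u (hsub u hu)).deriv, hslope, sub_nonneg,
        ← le_div_iff₀ (entropySlope_pos hN.1 hN.2)]
      exact antitoneOn_entropySlope_ratio hτ hu' hp hu.2
    exact hm (Set.left_mem_Icc.2 htp) (Set.right_mem_Icc.2 htp) htp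
  · have hm : AntitoneOn (fun t => Real.binEntropy t - s * Real.binEntropy (noiseParam t τ))
        (Set.Icc p t) := by
      have hsub : ∀ u ∈ Set.Icc p t, u ∈ Set.Ioo (0 : ℝ) 1 :=
        fun u hu => ⟨hp.1.trans_le hu.1, by linarith [hu.2]⟩
      refine antitoneOn_of_deriv_nonpos (convex_Icc _ _)
        (fun u hu => (hd u (hsub u hu)).continuousAt.continuousWithinAt)
        (fun u hu => (hd u (hsub u (interior_subset hu))).differentiableAt.differentiableWithinAt)
        ?_
      intro u hu
      rw [interior_Icc] at hu
      have hu' : u ∈ Set.Ioo (0 : ℝ) (1 / 2) := ⟨hp.1.trans hu.1, hu.2.trans_le h⟩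
      have hN := noiseParam_mem hu' hτ
      rw [(hd u (hsub u ⟨hu.1.le, hu.2.le⟩)).deriv, hslope, sub_nonpos,
        ← div_le_iff₀ (entropySlope_pos hN.1 hN.2)]
      exact antitoneOn_entropySlope_ratio hτ hp hu' hu.1.le
    exact hm (Set.left_mem_Icc.2 htp) (Set.right_mem_Icc.2 htp) htp

/-- Gibbs' inequality for two points. -/
theorem gibbs_two {t a b : ℝ} (ht : t ∈ Set.Ioo (0 : ℝ) 1) :
    Real.binEntropy t + (t * a + (1 - t) * b) ≤ Real.log (Real.exp a + Real.exp b) := by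
  have h0 := ht.1
  have h1 : 0 < 1 - t := by linarith [ht.2]
  have := strictConcaveOn_log_Ioi.concaveOn.2 (x := Real.exp a / t) (y := Real.exp b / (1 - t))
    (by rw [Set.mem_Ioi]; positivity) (by rw [Set.mem_Ioi]; positivity) h0.le h1.le (by ring)
  simp only [smul_eq_mul] at this
  rw [Real.log_div (by positivity) h0.ne', Real.log_div (by positivity) h1.ne', Real.log_exp,
    Real.log_exp, mul_div_cancel₀ _ h0.ne', mul_div_cancel₀ _ h1.ne'] at this
  rw [Real.binEntropy, Real.log_inv, Real.log_inv]
  linarith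

/-- The inequality for one bit. The sum on the left is, by the equality case of Gibbs' inequality,
`h(t) + s E log f(N(t))` for some distribution `t`; Gibbs' inequality bounds the expectation, and
Mrs. Gerber's lemma the difference of the entropies. -/
theorem noise_one_bit {p τ : ℝ} (hp : p ∈ Set.Ioo (0 : ℝ) (1 / 2))
    (hτ : τ ∈ Set.Ioo (0 : ℝ) (1 / 2)) (a b : ℝ) :
    Real.exp (gerberSlope p τ * ((1 - τ) * a + τ * b)) +
        Real.exp (gerberSlope p τ * (τ * a + (1 - τ) * b)) ≤
      Real.exp (gerberGap p τ) * Real.exp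
        (gerberSlope p τ * Real.log (Real.exp a + Real.exp b)) := by
  set s := gerberSlope p τ with hs
  set u := s * ((1 - τ) * a + τ * b) with hu
  set v := s * (τ * a + (1 - τ) * b) with hv
  set Z := Real.exp u + Real.exp v with hZ
  have hZ0 : 0 < Z := by positivity
  set t := Real.exp u / Z with ht
  have ht1 : 1 - t = Real.exp v / Z := by rw [ht, hZ]; field_simp; ring
  have ht0 : t ∈ Set.Ioo (0 : ℝ) 1 := by
    refine ⟨by positivity, ?_⟩
    have : 0 < Real.exp v / Z := by positivity
    linarith
  have e1 : Real.log Z = Real.binEntropy t + (t * u + (1 - t) * v) := by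
    rw [Real.binEntropy, Real.log_inv, Real.log_inv, ht1, ht, Real.log_div (by positivity)
      (by positivity), Real.log_div (by positivity) (by positivity), Real.log_exp, Real.log_exp,
      ← ht, ← ht1]
    ring
  have e2 : t * u + (1 - t) * v =
      s * (noiseParam t τ * a + (1 - noiseParam t τ) * b) - 0 := by
    rw [hu, hv, noiseParam]; ring
  have g1 := gibbs_two (a := a) (b := b) (noiseParam_mem_unit ht0 hτ)
  have g2 := entropy_sub_le_gerberGap hp hτ ht0
  have g3 := mul_le_mul_of_nonneg_left g1 (gerberSlope_pos hp hτ).le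
  rw [← hs] at g2 g3
  rw [← Real.exp_add, ← Real.exp_log hZ0, Real.exp_le_exp, e1, e2]
  linarith

/-! ### Expectation over the noise -/

/-- The expectation of `f` at the string obtained from `x` by flipping each bit independently with
probability `τ`, computed bit by bit. -/
noncomputable def noiseMean (τ : ℝ) : List Bool → (List Bool → ℝ) → ℝ
  | [], f => f []
  | b :: x, f => (1 - τ) * noiseMean τ x (fun y => f (b :: y)) +
      τ * noiseMean τ x (fun y => f ((!b) :: y))

theorem noiseMean_add (τ : ℝ) (x : List Bool) (f g : List Bool → ℝ) :
    noiseMean τ x (fun y => f y + g y) = noiseMean τ x f + noiseMean τ x g := by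
  induction x generalizing f g with
  | nil => rfl
  | cons b x ih => simp only [noiseMean, ih]; ring

theorem noiseMean_mul (τ c : ℝ) (x : List Bool) (f : List Bool → ℝ) :
    noiseMean τ x (fun y => c * f y) = c * noiseMean τ x f := by
  induction x generalizing f with
  | nil => rfl
  | cons b x ih => simp only [noiseMean, ih]; ring

theorem noiseMean_const (τ c : ℝ) (x : List Bool) : noiseMean τ x (fun _ => c) = c := by
  induction x with
  | nil => rfl
  | cons b x ih => simp only [noiseMean, ih]; ring

theorem noiseMean_mono {τ : ℝ} (hτ : τ ∈ Set.Icc (0 : ℝ) 1) {x : List Bool}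
    {f g : List Bool → ℝ} (h : ∀ y, y.length = x.length → f y ≤ g y) :
    noiseMean τ x f ≤ noiseMean τ x g := by
  induction x generalizing f g with
  | nil => exact h [] rfl
  | cons b x ih =>
    exact add_le_add
      (mul_le_mul_of_nonneg_left (ih fun y hy => h _ (by simp [hy])) (by linarith [hτ.2]))
      (mul_le_mul_of_nonneg_left (ih fun y hy => h _ (by simp [hy])) hτ.1)

theorem noiseMean_nonneg {τ : ℝ} (hτ : τ ∈ Set.Icc (0 : ℝ) 1) {x : List Bool}
    {f : List Bool → ℝ} (h : ∀ y, y.length = x.length → 0 ≤ f y) : 0 ≤ noiseMean τ x f := by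
  simpa only [noiseMean_const] using noiseMean_mono (g := f) (f := fun _ => 0) hτ h

theorem noiseMean_le {τ M : ℝ} (hτ : τ ∈ Set.Icc (0 : ℝ) 1) {x : List Bool}
    {f : List Bool → ℝ} (h : ∀ y, y.length = x.length → f y ≤ M) : noiseMean τ x f ≤ M := by
  simpa only [noiseMean_const] using noiseMean_mono (f := f) (g := fun _ => M) hτ h

/-- The mean depends on the noise level in a Lipschitz way, one bit at a time. -/
theorem abs_noiseMean_sub_le {σ τ M : ℝ} (hσ : σ ∈ Set.Icc (0 : ℝ) 1)
    (hτ : τ ∈ Set.Icc (0 : ℝ) 1) {x : List Bool} {f : List Bool → ℝ}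
    (h0 : ∀ y, y.length = x.length → 0 ≤ f y) (h1 : ∀ y, y.length = x.length → f y ≤ M) :
    |noiseMean σ x f - noiseMean τ x f| ≤ x.length * (M * |σ - τ|) := by
  induction x generalizing f with
  | nil => simp [noiseMean]
  | cons b x ih =>
    have hb : ∀ c : Bool, ∀ y : List Bool, y.length = x.length →
      (c :: y).length = (b :: x).length := fun c y hy => by simp [hy]
    have i1 := ih (f := fun y => f (b :: y)) (fun y hy => h0 _ (hb _ y hy))
      (fun y hy => h1 _ (hb _ y hy))
    have i2 := ih (f := fun y => f ((!b) :: y)) (fun y hy => h0 _ (hb _ y hy))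
      (fun y hy => h1 _ (hb _ y hy))
    have a1 := noiseMean_nonneg hτ (x := x) (f := fun y => f (b :: y)) fun y hy => h0 _ (hb _ y hy)
    have a2 := noiseMean_nonneg hτ (x := x) (f := fun y => f ((!b) :: y))
      fun y hy => h0 _ (hb _ y hy)
    have b1 := noiseMean_le hτ (x := x) (f := fun y => f (b :: y)) fun y hy => h1 _ (hb _ y hy)
    have b2 := noiseMean_le hτ (x := x) (f := fun y => f ((!b) :: y))
      fun y hy => h1 _ (hb _ y hy)
    simp only [noiseMean, List.length_cons, Nat.cast_add, Nat.cast_one]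
    generalize noiseMean σ x (fun y => f (b :: y)) = P at *
    generalize noiseMean τ x (fun y => f (b :: y)) = Q at *
    generalize noiseMean σ x (fun y => f ((!b) :: y)) = R at *
    generalize noiseMean τ x (fun y => f ((!b) :: y)) = S at *
    have e : (1 - σ) * P + σ * R - ((1 - τ) * Q + τ * S) =
        ((1 - σ) * (P - Q) + σ * (R - S)) + (S - Q) * (σ - τ) := by ring
    rw [e]
    refine (abs_add_le _ _).trans ?_
    have j1 : |(1 - σ) * (P - Q) + σ * (R - S)| ≤ x.length * (M * |σ - τ|) := by
      refine (abs_add_le _ _).trans ?_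
      rw [abs_mul, abs_mul, abs_of_nonneg hσ.1, abs_of_nonneg (sub_nonneg.2 hσ.2)]
      have := mul_le_mul_of_nonneg_left i1 (sub_nonneg.2 hσ.2)
      have := mul_le_mul_of_nonneg_left i2 hσ.1
      linarith
    have j2 : |(S - Q) * (σ - τ)| ≤ M * |σ - τ| := by
      rw [abs_mul]
      exact mul_le_mul_of_nonneg_right (abs_le.2 ⟨by linarith, by linarith⟩) (abs_nonneg _)
    linarith

/-! ### Tensorization of the one-bit inequality -/

theorem sum_ofFn_succ {M : Type*} [AddCommMonoid M] (n : ℕ) (F : List Bool → M) :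
    ∑ v : Fin (n + 1) → Bool, F (List.ofFn v) =
      (∑ v : Fin n → Bool, F (true :: List.ofFn v)) +
        ∑ v : Fin n → Bool, F (false :: List.ofFn v) := by
  rw [← (Fin.consEquiv fun _ : Fin (n + 1) => Bool).sum_comp, Fintype.sum_prod_type,
    Fintype.sum_bool]
  simp [Fin.consEquiv, List.ofFn_succ]

/-- The log-sum-exp function is convex; this is Hölder's inequality. -/
theorem sum_exp_convex {ι : Type*} [Fintype ι] [Nonempty ι] {τ : ℝ}
    (hτ : τ ∈ Set.Icc (0 : ℝ) 1) (u v : ι → ℝ) :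
    ∑ i, Real.exp ((1 - τ) * u i + τ * v i) ≤
      Real.exp ((1 - τ) * Real.log (∑ i, Real.exp (u i)) +
        τ * Real.log (∑ i, Real.exp (v i))) := by
  have hA : 0 < ∑ i, Real.exp (u i) :=
    Finset.sum_pos (fun i _ => Real.exp_pos _) Finset.univ_nonempty
  have hB : 0 < ∑ i, Real.exp (v i) :=
    Finset.sum_pos (fun i _ => Real.exp_pos _) Finset.univ_nonempty
  set A := ∑ i, Real.exp (u i) with hA'
  set B := ∑ i, Real.exp (v i) with hB'
  have key : ∀ i, Real.exp ((1 - τ) * u i + τ * v i) ≤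
      Real.exp ((1 - τ) * Real.log A + τ * Real.log B) *
        ((1 - τ) * (Real.exp (u i) / A) + τ * (Real.exp (v i) / B)) := by
    intro i
    have := convexOn_exp.2 (Set.mem_univ (u i - Real.log A)) (Set.mem_univ (v i - Real.log B))
      (sub_nonneg.2 hτ.2) hτ.1 (by ring)
    simp only [smul_eq_mul] at this
    rw [Real.exp_sub, Real.exp_sub, Real.exp_log hA, Real.exp_log hB] at this
    refine le_trans (le_of_eq ?_) (mul_le_mul_of_nonneg_left this (Real.exp_pos _).le)
    rw [← Real.exp_add]
    ring_nf
  refine (Finset.sum_le_sum fun i _ => key i).trans (le_of_eq ?_)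
  rw [← Finset.mul_sum, Finset.sum_add_distrib, ← Finset.mul_sum, ← Finset.mul_sum,
    ← Finset.sum_div, ← Finset.sum_div, ← hA', ← hB', div_self hA.ne', div_self hB.ne']
  ring

/-- The inequality for one bit tensorizes: the induction step splits off the first bit, with
Hölder's inequality for the remaining bits. -/
theorem sum_exp_noiseMean_le {p τ : ℝ} (hp : p ∈ Set.Ioo (0 : ℝ) (1 / 2))
    (hτ : τ ∈ Set.Ioo (0 : ℝ) (1 / 2)) (n : ℕ) (f : List Bool → ℝ) :
    ∑ v : Fin n → Bool, Real.exp (gerberSlope p τ * noiseMean τ (List.ofFn v) f) ≤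
      Real.exp (n * gerberGap p τ + gerberSlope p τ *
        Real.log (∑ v : Fin n → Bool, Real.exp (f (List.ofFn v)))) := by
  induction n generalizing f with
  | zero => simp [noiseMean]
  | succ n ih =>
    set s := gerberSlope p τ with hs
    set κ := gerberGap p τ with hκ
    have hτ' : τ ∈ Set.Icc (0 : ℝ) 1 := ⟨hτ.1.le, by linarith [hτ.2]⟩
    set S : Bool → ℝ := fun b => ∑ v : Fin n → Bool, Real.exp (f (b :: List.ofFn v)) with hS
    have hSpos : ∀ b, 0 < S b := fun b =>
      Finset.sum_pos (fun i _ => Real.exp_pos _) Finset.univ_nonempty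
    have hbit : ∀ b : Bool,
        ∑ v : Fin n → Bool, Real.exp (s * noiseMean τ (b :: List.ofFn v) f) ≤
          Real.exp (n * κ) * Real.exp (s * ((1 - τ) * Real.log (S b) + τ * Real.log (S !b))) := by
      intro b
      have hlog : ∀ c : Bool, Real.log (∑ v : Fin n → Bool,
          Real.exp (s * noiseMean τ (List.ofFn v) fun y => f (c :: y))) ≤
            n * κ + s * Real.log (S c) := by
        intro c
        rw [Real.log_le_iff_le_exp
          (Finset.sum_pos (fun i _ => Real.exp_pos _) Finset.univ_nonempty)]
        exact ih _
      have h := sum_exp_convex hτ'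
        (fun v : Fin n → Bool => s * noiseMean τ (List.ofFn v) fun y => f (b :: y))
        (fun v : Fin n → Bool => s * noiseMean τ (List.ofFn v) fun y => f ((!b) :: y))
      have e : ∀ v : Fin n → Bool, s * noiseMean τ (b :: List.ofFn v) f =
          (1 - τ) * (s * noiseMean τ (List.ofFn v) fun y => f (b :: y)) +
            τ * (s * noiseMean τ (List.ofFn v) fun y => f ((!b) :: y)) := by
        intro v; rw [noiseMean]; ring
      simp only [e]
      refine h.trans ?_
      rw [← Real.exp_add, Real.exp_le_exp]
      have h1 := mul_le_mul_of_nonneg_left (hlog b) (sub_nonneg.2 hτ'.2)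
      have h2 := mul_le_mul_of_nonneg_left (hlog !b) hτ'.1
      linarith
    rw [sum_ofFn_succ n fun y => Real.exp (s * noiseMean τ y f),
      sum_ofFn_succ n fun y => Real.exp (f y)]
    have h1 := noise_one_bit hp hτ (Real.log (S true)) (Real.log (S false))
    rw [Real.exp_log (hSpos _), Real.exp_log (hSpos _), ← hs, ← hκ] at h1
    have h2 := hbit true
    have h3 := hbit false
    simp only [Bool.not_true, Bool.not_false] at h2 h3
    rw [add_comm ((1 - τ) * Real.log (S false))] at h3
    have h4 := mul_le_mul_of_nonneg_left h1 (Real.exp_pos (n * κ)).le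
    refine (add_le_add h2 h3).trans ?_
    rw [← mul_add]
    refine h4.trans (le_of_eq ?_)
    rw [← Real.exp_add, ← Real.exp_add]
    congr 1
    simp only [hS]
    push_cast
    ring

/-! ### Concentration of functions of a noisy string -/

/-- Single bit flips within strings of length `n` change `f` by at most `d`. -/
def IsFlipLipschitz (n : ℕ) (d : ℝ) (f : List Bool → ℝ) : Prop :=
  ∀ (u v : List Bool) (b c : Bool), (u ++ b :: v).length = n →
    |f (u ++ b :: v) - f (u ++ c :: v)| ≤ d

theorem IsFlipLipschitz.cons {n : ℕ} {d : ℝ} {f : List Bool → ℝ}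
    (hf : IsFlipLipschitz (n + 1) d f) (a : Bool) : IsFlipLipschitz n d fun y => f (a :: y) := by
  intro u v b c h
  refine hf (a :: u) v b c ?_
  simpa using h

/-- McDiarmid's inequality on the level of moment generating functions. -/
theorem noiseMean_exp_le {τ d l : ℝ} (hτ : τ ∈ Set.Icc (0 : ℝ) 1) (hl : 0 ≤ l) (hld : l * d ≤ 1)
    {x : List Bool} {f : List Bool → ℝ} (hf : IsFlipLipschitz x.length d f) :
    noiseMean τ x (fun y => Real.exp (l * (noiseMean τ x f - f y))) ≤
      Real.exp (x.length * (l * d) ^ 2) := by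
  induction x generalizing f with
  | nil => simp [noiseMean]
  | cons b x ih =>
    have hd : ∀ c : Bool, |noiseMean τ x (fun y => f (c :: y)) -
        noiseMean τ x (fun y => f ((!c) :: y))| ≤ d := by
      intro c
      have e : noiseMean τ x (fun y => f (c :: y)) - noiseMean τ x (fun y => f ((!c) :: y)) =
          noiseMean τ x (fun y => f (c :: y) + (-1) * f ((!c) :: y)) := by
        rw [noiseMean_add, noiseMean_mul]; ring
      have h1 : ∀ y : List Bool, y.length = x.length → |f (c :: y) - f ((!c) :: y)| ≤ d :=
        fun y hy => hf [] y c (!c) (by simp [hy])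
      rw [e, abs_le]
      constructor
      · rw [← noiseMean_const τ (-d) x]
        exact noiseMean_mono hτ fun y hy => by linarith [(abs_le.1 (h1 y hy)).1]
      · exact noiseMean_le hτ fun y hy => by linarith [(abs_le.1 (h1 y hy)).2]
    have hd0 : 0 ≤ d := (abs_nonneg _).trans (hd true)
    set P : ℝ := noiseMean τ x (fun y => f (b :: y)) with hP
    set Q : ℝ := noiseMean τ x (fun y => f ((!b) :: y)) with hQ
    set M : ℝ := noiseMean τ (b :: x) f with hM
    have hM' : M = (1 - τ) * P + τ * Q := rfl
    have hbit : ∀ c : Bool, noiseMean τ x (fun y => Real.exp (l * (M - f (c :: y)))) ≤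
        Real.exp (l * (M - noiseMean τ x (fun y => f (c :: y)))) *
          Real.exp (x.length * (l * d) ^ 2) := by
      intro c
      refine le_trans (le_of_eq ?_)
        (mul_le_mul_of_nonneg_left (ih (hf.cons c)) (Real.exp_pos _).le)
      rw [← noiseMean_mul]
      congr 1
      ext y
      rw [← Real.exp_add]
      ring_nf
    have hquad : ∀ z : ℝ, |z| ≤ l * d → Real.exp z ≤ 1 + z + (l * d) ^ 2 := by
      intro z hz
      have h1 := (abs_le.1 (Real.abs_exp_sub_one_sub_id_le (hz.trans hld))).2
      have h2 : z ^ 2 ≤ (l * d) ^ 2 := sq_le_sq' (abs_le.1 hz).1 (abs_le.1 hz).2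
      linarith
    have hb := hd b
    rw [← hP, ← hQ] at hb
    have q1 : Real.exp (l * (M - P)) ≤ 1 + l * (M - P) + (l * d) ^ 2 := by
      refine hquad _ ?_
      rw [show l * (M - P) = l * (-τ * (P - Q)) by rw [hM']; ring, abs_mul, abs_mul,
        abs_of_nonneg hl, abs_neg, abs_of_nonneg hτ.1]
      refine mul_le_mul_of_nonneg_left ?_ hl
      nlinarith [abs_nonneg (P - Q), hτ.2]
    have q2 : Real.exp (l * (M - Q)) ≤ 1 + l * (M - Q) + (l * d) ^ 2 := by
      refine hquad _ ?_
      rw [show l * (M - Q) = l * ((1 - τ) * (P - Q)) by rw [hM']; ring, abs_mul, abs_mul,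
        abs_of_nonneg hl, abs_of_nonneg (sub_nonneg.2 hτ.2)]
      refine mul_le_mul_of_nonneg_left ?_ hl
      nlinarith [abs_nonneg (P - Q), hτ.1]
    have h1 := mul_le_mul_of_nonneg_left (hbit b) (sub_nonneg.2 hτ.2)
    have h2 := mul_le_mul_of_nonneg_left (hbit !b) hτ.1
    have h3 : (1 - τ) * Real.exp (l * (M - P)) + τ * Real.exp (l * (M - Q)) ≤
        Real.exp ((l * d) ^ 2) := by
      have := Real.add_one_le_exp ((l * d) ^ 2)
      have h4 := mul_le_mul_of_nonneg_left q1 (sub_nonneg.2 hτ.2)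
      have h5 := mul_le_mul_of_nonneg_left q2 hτ.1
      have : (1 - τ) * (1 + l * (M - P) + (l * d) ^ 2) + τ * (1 + l * (M - Q) + (l * d) ^ 2) =
          1 + (l * d) ^ 2 := by rw [hM']; ring
      linarith
    rw [noiseMean]
    calc _ ≤ _ := add_le_add h1 h2
      _ = ((1 - τ) * Real.exp (l * (M - P)) + τ * Real.exp (l * (M - Q))) *
            Real.exp (x.length * (l * d) ^ 2) := by rw [← hP, ← hQ]; ring
      _ ≤ Real.exp ((l * d) ^ 2) * Real.exp (x.length * (l * d) ^ 2) :=
          mul_le_mul_of_nonneg_right h3 (Real.exp_pos _).le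
      _ = _ := by rw [← Real.exp_add, List.length_cons]; push_cast; ring_nf

/-! ### Plain complexity -/

theorem plainComplexity_le {D : Decompressor} {x q : List Bool} (h : x ∈ D q) :
    plainComplexity D x ≤ q.length :=
  Nat.sInf_le ⟨q, h, rfl⟩

theorem Decompressor.IsOptimal.exists_shortest {D : Decompressor} (hD : D.IsOptimal)
    (x : List Bool) : ∃ q, x ∈ D q ∧ q.length = plainComplexity D x := by
  obtain ⟨q, hq⟩ := hD.exists_program x
  exact Nat.sInf_mem (s := {l : ℕ | ∃ p : List Bool, x ∈ D p ∧ p.length = l}) ⟨_, q, hq, rfl⟩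

theorem Decompressor.IsOptimal.exists_le_length {D : Decompressor} (hD : D.IsOptimal) :
    ∃ c : ℕ, ∀ x, plainComplexity D x ≤ x.length + c := by
  obtain ⟨c, hc⟩ := hD.2 (fun p => Part.some p) Partrec.some
  refine ⟨c, fun x => ?_⟩
  obtain ⟨q, hq, hl⟩ := hc x x (Part.mem_some x)
  exact (plainComplexity_le hq).trans hl

/-- Kraft's inequality up to a linear factor: at most `2 ^ k` strings have complexity `k`. -/
theorem Decompressor.IsOptimal.sum_exp_neg_le {D : Decompressor} (hD : D.IsOptimal) {n M : ℕ}
    (hM : ∀ x : List Bool, x.length = n → plainComplexity D x ≤ M) :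
    ∑ v : Fin n → Bool, Real.exp (-Real.log 2 * plainComplexity D (List.ofFn v)) ≤ M + 1 := by
  have hmap : ∀ v ∈ (Finset.univ : Finset (Fin n → Bool)),
      plainComplexity D (List.ofFn v) ∈ Finset.range (M + 1) := fun v _ =>
    Finset.mem_range.2 (Nat.lt_succ_of_le (hM _ (by simp)))
  rw [← Finset.sum_fiberwise_of_maps_to hmap]
  have hk : ∀ k ∈ Finset.range (M + 1),
      ∑ v ∈ (Finset.univ : Finset (Fin n → Bool)) with plainComplexity D (List.ofFn v) = k,
        Real.exp (-Real.log 2 * plainComplexity D (List.ofFn v)) ≤ 1 := by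
    intro k _
    have hcard : (Finset.univ.filter fun v : Fin n → Bool =>
        plainComplexity D (List.ofFn v) = k).card ≤ 2 ^ k := by
      have hq : ∀ v : Fin n → Bool, plainComplexity D (List.ofFn v) = k →
          ∃ q : Fin k → Bool, List.ofFn v ∈ D (List.ofFn q) := by
        intro v hv
        obtain ⟨q, hq, hl⟩ := hD.exists_shortest (List.ofFn v)
        obtain rfl : q.length = k := hl.trans hv
        exact ⟨q.get, by rwa [List.ofFn_get]⟩
      choose! g hg using hq
      have := Finset.card_le_card_of_injOn (s := Finset.univ.filter fun v : Fin n → Bool =>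
        plainComplexity D (List.ofFn v) = k) (t := (Finset.univ : Finset (Fin k → Bool))) g
        (fun _ _ => Finset.mem_coe.2 (Finset.mem_univ _)) (by
          intro v hv w hw h
          simp only [Finset.coe_filter, Finset.mem_univ, true_and, Set.mem_ofPred_eq] at hv hw
          have h1 := hg v hv
          rw [h] at h1
          exact List.ofFn_injective (Part.mem_unique h1 (hg w hw)))
      simpa using this
    have hterm : ∀ v ∈ (Finset.univ.filter fun v : Fin n → Bool =>
        plainComplexity D (List.ofFn v) = k),
        Real.exp (-Real.log 2 * plainComplexity D (List.ofFn v)) = ((2 : ℝ) ^ k)⁻¹ := by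
      intro v hv
      rw [(Finset.mem_filter.1 hv).2, neg_mul, Real.exp_neg, mul_comm, Real.exp_nat_mul,
        Real.exp_log two_pos]
    rw [Finset.sum_congr rfl hterm, Finset.sum_const, nsmul_eq_mul, ← div_eq_mul_inv,
      div_le_one (by positivity)]
    exact_mod_cast hcard
  refine (Finset.sum_le_sum hk).trans (le_of_eq ?_)
  simp

/-! ### Descriptions by a program and a parameter -/

/-- The number with binary digits `l`, least significant digit first. -/
def binaryValue (l : List Bool) : ℕ :=
  l.foldr (fun b r => 2 * r + bif b then 1 else 0) 0

theorem primrec_binaryValue : Primrec binaryValue := by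
  refine Primrec.list_foldr (f := fun l : List Bool => l) (g := fun _ => 0)
    (h := fun _ z => 2 * z.2 + bif z.1 then 1 else 0) Primrec.id (Primrec.const 0) ?_
  have hr : Primrec fun z : List Bool × (Bool × ℕ) => z.2 := Primrec.snd
  exact Primrec.nat_add.comp (Primrec.nat_mul.comp (Primrec.const 2) (Primrec.snd.comp hr))
    (Primrec.cond (Primrec.fst.comp hr) (Primrec.const 1) (Primrec.const 0))

theorem exists_binaryValue_eq {a k : ℕ} (h : a < 2 ^ k) :
    ∃ l : List Bool, l.length = k ∧ binaryValue l = a := by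
  induction k generalizing a with
  | zero => exact ⟨[], rfl, by simp [binaryValue]; omega⟩
  | succ k ih =>
    obtain ⟨l, hl, hv⟩ := ih (a := a / 2) (by rw [pow_succ] at h; omega)
    refine ⟨decide (a % 2 = 1) :: l, by simp [hl], ?_⟩
    have : binaryValue (decide (a % 2 = 1) :: l) =
      2 * binaryValue l + bif decide (a % 2 = 1) then 1 else 0 := rfl
    rw [this, hv]
    rcases Nat.mod_two_eq_zero_or_one a with h | h <;> simp [h] <;> omega

/-- A partial computable map with a parameter `a < 2 ^ k` increases the complexity by at most
`2 k + O(1)`: the program consists of `k` in unary, the `k` digits of `a`, and a program for the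
argument. -/
theorem Decompressor.IsOptimal.exists_map_le {D : Decompressor} (hD : D.IsOptimal)
    {F : ℕ × List Bool →. List Bool} (hF : Partrec F) :
    ∃ c : ℕ, ∀ (k a : ℕ) (x y : List Bool), a < 2 ^ k → x ∈ F (a, y) →
      plainComplexity D x ≤ plainComplexity D y + 2 * k + c := by
  have hs : Primrec splitProgram := splitProgram_primrec
  have hdrop : Primrec fun r => (splitProgram r).2.drop (splitProgram r).1 :=
    Primrec.list_drop.comp (Primrec.fst.comp hs) (Primrec.snd.comp hs)
  have htake : Primrec fun r => binaryValue ((splitProgram r).2.take (splitProgram r).1) :=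
    primrec_binaryValue.comp (Primrec.list_take.comp (Primrec.fst.comp hs) (Primrec.snd.comp hs))
  have hD' : Partrec fun r : List Bool =>
      (D ((splitProgram r).2.drop (splitProgram r).1)).bind fun y =>
        F (binaryValue ((splitProgram r).2.take (splitProgram r).1), y) :=
    Partrec.bind (hD.1.comp hdrop.to_comp)
      (hF.comp (Computable.pair (htake.to_comp.comp Computable.fst) Computable.snd))
  obtain ⟨c, hc⟩ := hD.2 _ hD'
  refine ⟨c + 1, fun k a x y ha hx => ?_⟩
  obtain ⟨l, hl, hv⟩ := exists_binaryValue_eq ha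
  obtain ⟨q, hq, hql⟩ := hD.exists_shortest y
  obtain ⟨r, hr, hrl⟩ := hc (List.replicate k true ++ false :: (l ++ q)) x (by
    simp only [splitProgram_append, ← hl, List.drop_left, List.take_left, hv]
    exact Part.mem_bind hq hx)
  refine (plainComplexity_le hr).trans (hrl.trans (le_of_eq ?_))
  simp only [List.length_append, List.length_replicate, List.length_cons, hl, hql]
  ring

/-- Flipping one bit changes the complexity by the description length of its position. -/
theorem Decompressor.IsOptimal.exists_isFlipLipschitz {D : Decompressor} (hD : D.IsOptimal) :
    ∃ c : ℕ, ∀ n k : ℕ, n ≤ 2 ^ k →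
      IsFlipLipschitz n (2 * k + c) fun x => plainComplexity D x := by
  have hF : Primrec fun z : ℕ × List Bool => z.2.set (Nat.div2 z.1) (Nat.bodd z.1) :=
    Primrec.list_set.comp Primrec.snd (Primrec.pair (Primrec.nat_div2.comp Primrec.fst)
      (Primrec.nat_bodd.comp Primrec.fst))
  obtain ⟨c, hc⟩ := hD.exists_map_le (F := fun z => Part.some _) hF.to_comp
  refine ⟨c + 2, fun n k hn u v b b' h => ?_⟩
  have key : ∀ b b' : Bool, plainComplexity D (u ++ b' :: v) ≤
      plainComplexity D (u ++ b :: v) + 2 * (k + 1) + c := by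
    intro b b'
    refine hc (k + 1) (Nat.bit b' u.length) _ _ ?_ ?_
    · have : u.length < n := by rw [← h]; simp
      rw [pow_succ]
      cases b' <;> simp [Nat.bit] <;> omega
    · simp
  have h1 := key b b'
  have h2 := key b' b
  rw [abs_le]
  constructor
  · have : (plainComplexity D (u ++ b' :: v) : ℝ) ≤
      plainComplexity D (u ++ b :: v) + 2 * (k + 1) + c := by exact_mod_cast h1
    push_cast
    linarith
  · have : (plainComplexity D (u ++ b :: v) : ℝ) ≤
      plainComplexity D (u ++ b' :: v) + 2 * (k + 1) + c := by exact_mod_cast h2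
    push_cast
    linarith

/-! ### Descriptions by the number in an enumeration -/

/-- The string with code `j`, or the empty string if there is none. -/
def stringOfCode (j : ℕ) : List Bool := (Encodable.decode (α := List Bool) j).getD []

theorem primrec_stringOfCode : Primrec stringOfCode :=
  Primrec.option_getD.comp Primrec.decode (Primrec.const [])

@[simp] theorem stringOfCode_encode (x : List Bool) : stringOfCode (Encodable.encode x) = x := by
  simp [stringOfCode]

/-- The pair of `y` and `t` with code `j` satisfies `P y t`, and no smaller `t` does. Irreducible,
since unfolding the decision procedures makes unification of computability goals diverge. -/
@[irreducible] def firstHit (P : List Bool → ℕ → Bool) (j : ℕ) : Bool :=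
  decide (Encodable.encode (stringOfCode j.unpair.1) = j.unpair.1) &&
    (P (stringOfCode j.unpair.1) j.unpair.2 &&
      decide (∀ t < j.unpair.2, P (stringOfCode j.unpair.1) t = false))

/-- The number of first hits with a code less than `j`. -/
def firstHitCount (P : List Bool → ℕ → Bool) (j : ℕ) : ℕ :=
  Nat.rec 0 (fun i r => bif firstHit P i then r + 1 else r) j

theorem firstHit_pair {P : List Bool → ℕ → Bool} {x : List Bool} (hx : ∃ t, P x t = true) :
    ∃ j, firstHit P j = true ∧ stringOfCode j.unpair.1 = x := by
  refine ⟨Nat.pair (Encodable.encode x) (Nat.find hx), ?_, by simp⟩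
  simp only [firstHit, Nat.unpair_pair, stringOfCode_encode, Bool.and_eq_true,
    decide_eq_true_eq, true_and]
  exact ⟨Nat.find_spec hx, fun t ht => by simpa using Nat.find_min hx ht⟩

theorem firstHit_injOn (P : List Bool → ℕ → Bool) :
    Set.InjOn (fun i : ℕ => stringOfCode i.unpair.1) {i | firstHit P i = true} := by
  intro i hi i' hi' h
  simp only [Set.mem_ofPred_eq, firstHit, Bool.and_eq_true, decide_eq_true_eq] at hi hi'
  simp only at h
  rw [h] at hi
  have e1 : i.unpair.1 = i'.unpair.1 := hi.1.symm.trans hi'.1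
  have e2 : i.unpair.2 = i'.unpair.2 := by
    rcases lt_trichotomy i.unpair.2 i'.unpair.2 with hl | hl | hl
    · have := hi'.2.2 _ hl
      rw [hi.2.1] at this
      cases this
    · exact hl
    · have := hi.2.2 _ hl
      rw [hi'.2.1] at this
      cases this
  rw [← Nat.pair_unpair i, ← Nat.pair_unpair i', e1, e2]

theorem firstHitCount_eq (P : List Bool → ℕ → Bool) (j : ℕ) :
    firstHitCount P j = Nat.count (fun i => firstHit P i = true) j := by
  induction j with
  | zero => simp [firstHitCount]
  | succ j ih =>
    rw [Nat.count_succ, ← ih]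
    show (bif firstHit P j then firstHitCount P j + 1 else firstHitCount P j) = _
    cases firstHit P j <;> simp

theorem firstHitCount_lt_card {P : List Bool → ℕ → Bool} {T : Finset (List Bool)}
    (hT : ∀ y t, P y t = true → y ∈ T) {j : ℕ} (hj : firstHit P j = true) :
    firstHitCount P j < T.card := by
  have h1 : firstHitCount P j + 1 = Nat.count (fun i => firstHit P i = true) (j + 1) := by
    rw [Nat.count_succ, firstHitCount_eq]; simp [hj]
  rw [Nat.lt_iff_add_one_le, h1, Nat.count_eq_card_filter_range]
  refine Finset.card_le_card_of_injOn (fun i => stringOfCode i.unpair.1) ?_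
    ((firstHit_injOn P).mono fun i hi => (Finset.mem_filter.1 (Finset.mem_coe.1 hi)).2)
  intro i hi
  have hi := (Finset.mem_filter.1 (Finset.mem_coe.1 hi)).2
  simp only [firstHit, Bool.and_eq_true] at hi
  exact hT _ _ hi.2.1

theorem primrec_firstHit {P : ℕ → List Bool → ℕ → Bool}
    (hP : Primrec fun z : (ℕ × List Bool) × ℕ => P z.1.1 z.1.2 z.2) :
    Primrec fun z : ℕ × ℕ => firstHit (P z.1) z.2 := by
  have hfst : Primrec fun z : ℕ × ℕ => z.2.unpair.1 :=
    Primrec.fst.comp (Primrec.unpair.comp Primrec.snd)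
  have hsnd : Primrec fun z : ℕ × ℕ => z.2.unpair.2 :=
    Primrec.snd.comp (Primrec.unpair.comp Primrec.snd)
  have hstr : Primrec fun z : ℕ × ℕ => stringOfCode z.2.unpair.1 := primrec_stringOfCode.comp hfst
  have h3 : Primrec fun z : ℕ × ℕ =>
      decide (∀ t < z.2.unpair.2, P z.1 (stringOfCode z.2.unpair.1) t = false) := by
    have hR : PrimrecRel fun (t : ℕ) (w : ℕ × List Bool) => P w.1 w.2 t = false :=
      Primrec.eq.comp (hP.comp (Primrec.pair Primrec.snd Primrec.fst)) (Primrec.const false)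
    have hR2 : PrimrecRel fun (n : ℕ) (w : ℕ × List Bool) => ∀ t < n, P w.1 w.2 t = false :=
      (hR.forall_mem_list.comp (Primrec.list_range.comp Primrec.fst) Primrec.snd).of_eq
        fun z => by simp
    have hR3 : PrimrecPred fun z : ℕ × ℕ =>
        ∀ t < z.2.unpair.2, P z.1 (stringOfCode z.2.unpair.1) t = false :=
      PrimrecRel.comp hR2 hsnd (Primrec.pair Primrec.fst hstr)
    exact hR3.decide
  simp only [firstHit]
  exact Primrec.and.comp (Primrec.eq.comp (Primrec.encode.comp hstr) hfst).decide
    (Primrec.and.comp (hP.comp (Primrec.pair (Primrec.pair Primrec.fst hstr) hsnd)) h3)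

theorem primrec_firstHitCount {P : ℕ → List Bool → ℕ → Bool}
    (hP : Primrec fun z : (ℕ × List Bool) × ℕ => P z.1.1 z.1.2 z.2) :
    Primrec fun z : ℕ × ℕ => firstHitCount (P z.1) z.2 := by
  have h1 : Primrec fun w : (ℕ × ℕ) × (ℕ × ℕ) => firstHit (P w.1.1) w.2.1 :=
    (primrec_firstHit (P := P) hP).comp
      (Primrec.pair (Primrec.fst.comp Primrec.fst) (Primrec.fst.comp Primrec.snd))
  have h2 : Primrec fun w : (ℕ × ℕ) × (ℕ × ℕ) => w.2.2 := Primrec.snd.comp Primrec.snd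
  exact Primrec.nat_rec' (f := fun z : ℕ × ℕ => z.2) (g := fun _ => 0)
    (h := fun z w => bif firstHit (P z.1) w.1 then w.2 + 1 else w.2) Primrec.snd (Primrec.const 0)
    (Primrec.cond h1 (Primrec.succ.comp h2) h2)

/-- The string confirmed by the first hit whose number in the enumeration has the digits `z.2`. -/
def nthConfirmed (P : ℕ → List Bool → ℕ → Bool) (z : ℕ × List Bool) : Part (List Bool) :=
  (Nat.rfind fun j => Part.some
    (firstHit (P z.1) j && decide (firstHitCount (P z.1) j = binaryValue z.2))).map
      fun j => stringOfCode j.unpair.1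

theorem partrec_nthConfirmed {P : ℕ → List Bool → ℕ → Bool}
    (hP : Primrec fun z : (ℕ × List Bool) × ℕ => P z.1.1 z.1.2 z.2) :
    Partrec (nthConfirmed P) := by
  have h1 : Primrec fun w : (ℕ × List Bool) × ℕ => (w.1.1, w.2) :=
    Primrec.pair (Primrec.fst.comp Primrec.fst) Primrec.snd
  have hc : Primrec fun w : (ℕ × List Bool) × ℕ => firstHitCount (P w.1.1) w.2 :=
    (primrec_firstHitCount (P := P) hP).comp h1
  have hv : Primrec fun w : (ℕ × List Bool) × ℕ => binaryValue w.1.2 :=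
    primrec_binaryValue.comp (Primrec.snd.comp Primrec.fst)
  have he : PrimrecPred fun w : (ℕ × List Bool) × ℕ =>
      firstHitCount (P w.1.1) w.2 = binaryValue w.1.2 := PrimrecRel.comp Primrec.eq hc hv
  have hf : Primrec fun w : (ℕ × List Bool) × ℕ => firstHit (P w.1.1) w.2 :=
    (primrec_firstHit (P := P) hP).comp h1
  have hd : Primrec fun w : (ℕ × List Bool) × ℕ =>
      decide (firstHitCount (P w.1.1) w.2 = binaryValue w.1.2) := he.decide
  have h2 : Primrec fun w : (ℕ × List Bool) × ℕ =>
      firstHit (P w.1.1) w.2 && decide (firstHitCount (P w.1.1) w.2 = binaryValue w.1.2) :=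
    Primrec.and.comp hf hd
  have h3 : Partrec₂ fun (z : ℕ × List Bool) (j : ℕ) => Part.some
      (firstHit (P z.1) j && decide (firstHitCount (P z.1) j = binaryValue z.2)) := by
    generalize hg : (fun w : (ℕ × List Bool) × ℕ =>
      firstHit (P w.1.1) w.2 && decide (firstHitCount (P w.1.1) w.2 = binaryValue w.1.2)) = g at h2
    have e : ∀ (z : ℕ × List Bool) (j : ℕ), (firstHit (P z.1) j &&
        decide (firstHitCount (P z.1) j = binaryValue z.2)) = g (z, j) := by
      intro z j; rw [← hg]
    simp only [e]
    exact h2.to_comp.partrec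
  have h4 : Computable₂ fun (_ : ℕ × List Bool) (j : ℕ) => stringOfCode j.unpair.1 :=
    (primrec_stringOfCode.comp (Primrec.fst.comp (Primrec.unpair.comp Primrec.snd))).to_comp
  exact (Partrec.rfind h3).map h4

theorem mem_nthConfirmed {P : ℕ → List Bool → ℕ → Bool} {a j : ℕ} {l : List Bool}
    (hj : firstHit (P a) j = true) (hl : binaryValue l = firstHitCount (P a) j) :
    stringOfCode j.unpair.1 ∈ nthConfirmed P (a, l) := by
  refine (Part.mem_map_iff _).2 ⟨j, Nat.mem_rfind.2 ⟨?_, fun {i} hi => ?_⟩, rfl⟩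
  · simp [hj, hl]
  · rw [Part.mem_some_iff, eq_comm, Bool.and_eq_false_iff]
    by_cases hh : firstHit (P a) i = true
    · right
      rw [hl, decide_eq_false_iff_not, firstHitCount_eq, firstHitCount_eq]
      exact fun he => hi.ne (Nat.count_injective (p := fun i => firstHit (P a) i = true) hh hj he)
    · left; simpa using hh

/-- Members of an enumerable set of size at most `2 ^ m` with parameter `a < 2 ^ k` have
complexity at most `m + 2 k + O(1)`: such a member is determined by its number in the enumeration
of the pairs of a string and the first stage that confirms it. -/
theorem Decompressor.IsOptimal.exists_enumeration_le {D : Decompressor} (hD : D.IsOptimal)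
    {P : ℕ → List Bool → ℕ → Bool}
    (hP : Primrec fun z : (ℕ × List Bool) × ℕ => P z.1.1 z.1.2 z.2) :
    ∃ c : ℕ, ∀ (k a m : ℕ) (T : Finset (List Bool)) (x : List Bool), a < 2 ^ k →
      (∃ t, P a x t = true) → (∀ y t, P a y t = true → y ∈ T) → T.card ≤ 2 ^ m →
        plainComplexity D x ≤ m + 2 * k + c := by
  obtain ⟨c, hc⟩ := hD.exists_map_le (partrec_nthConfirmed (P := P) hP)
  obtain ⟨c', hc'⟩ := hD.exists_le_length
  refine ⟨c + c', fun k a m T x ha hx hT hcard => ?_⟩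
  obtain ⟨j, hj, rfl⟩ := firstHit_pair hx
  obtain ⟨l, hl, hv⟩ := exists_binaryValue_eq ((firstHitCount_lt_card hT hj).trans_le hcard)
  have h2 := hc k a _ l ha (mem_nthConfirmed hj hv)
  have h3 := hc' l
  omega

/-! ### Approximation of the complexity from above -/

/-- The least length of a program for `y` with a code less than `s` that halts within `t` steps, or
`L` if there is none of length less than `L`; the decompressor is given by its code `C`. -/
def stageComplexity (C : Nat.Partrec.Code) (t L : ℕ) (y : List Bool) (s : ℕ) : ℕ :=
  Nat.rec L (fun i r =>
    bif decide (C.evaln t i = some (Encodable.encode y)) then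
      min r (stringOfCode i).length else r) s

theorem primrec_stageComplexity (C : Nat.Partrec.Code) :
    Primrec fun z : (ℕ × ℕ) × List Bool => stageComplexity C z.1.1 z.1.2 z.2 z.1.1 := by
  have ht : Primrec fun w : ((ℕ × ℕ) × List Bool) × (ℕ × ℕ) => w.1.1.1 :=
    Primrec.fst.comp (Primrec.fst.comp Primrec.fst)
  have hi : Primrec fun w : ((ℕ × ℕ) × List Bool) × (ℕ × ℕ) => w.2.1 :=
    Primrec.fst.comp Primrec.snd
  have hr : Primrec fun w : ((ℕ × ℕ) × List Bool) × (ℕ × ℕ) => w.2.2 :=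
    Primrec.snd.comp Primrec.snd
  have hev : Primrec fun w : ((ℕ × ℕ) × List Bool) × (ℕ × ℕ) => C.evaln w.1.1.1 w.2.1 :=
    Nat.Partrec.Code.primrec_evaln.comp (Primrec.pair (Primrec.pair ht (Primrec.const C)) hi)
  have hy : Primrec fun w : ((ℕ × ℕ) × List Bool) × (ℕ × ℕ) => some (Encodable.encode w.1.2) :=
    Primrec.option_some.comp (Primrec.encode.comp (Primrec.snd.comp Primrec.fst))
  have he : PrimrecPred fun w : ((ℕ × ℕ) × List Bool) × (ℕ × ℕ) =>
      C.evaln w.1.1.1 w.2.1 = some (Encodable.encode w.1.2) := PrimrecRel.comp Primrec.eq hev hy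
  have hl : Primrec fun w : ((ℕ × ℕ) × List Bool) × (ℕ × ℕ) => (stringOfCode w.2.1).length :=
    Primrec.list_length.comp (primrec_stringOfCode.comp hi)
  exact Primrec.nat_rec' (f := fun z : (ℕ × ℕ) × List Bool => z.1.1) (g := fun z => z.1.2)
    (h := fun z w => bif decide (C.evaln z.1.1 w.1 = some (Encodable.encode z.2)) then
      min w.2 (stringOfCode w.1).length else w.2)
    (Primrec.fst.comp Primrec.fst) (Primrec.snd.comp Primrec.fst)
    (Primrec.cond he.decide (Primrec.nat_min.comp hr hl) hr)

theorem stageComplexity_succ (C : Nat.Partrec.Code) (t L : ℕ) (y : List Bool) (s : ℕ) :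
    stageComplexity C t L y (s + 1) =
      if C.evaln t s = some (Encodable.encode y) then
        min (stageComplexity C t L y s) (stringOfCode s).length else stageComplexity C t L y s := by
  show (bif decide (C.evaln t s = some (Encodable.encode y)) then
    min (stageComplexity C t L y s) (stringOfCode s).length else stageComplexity C t L y s) = _
  by_cases h : C.evaln t s = some (Encodable.encode y) <;> simp [h]

theorem le_stageComplexity {C : Nat.Partrec.Code} {t L l s : ℕ} {y : List Bool} (hL : l ≤ L)
    (h : ∀ i, C.evaln t i = some (Encodable.encode y) → l ≤ (stringOfCode i).length) :
    l ≤ stageComplexity C t L y s := by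
  induction s with
  | zero => exact hL
  | succ s ih =>
    rw [stageComplexity_succ]
    split_ifs with hs
    · exact le_min ih (h s hs)
    · exact ih

theorem stageComplexity_le {C : Nat.Partrec.Code} {t L i s : ℕ} {y : List Bool} (his : i < s)
    (h : C.evaln t i = some (Encodable.encode y)) :
    stageComplexity C t L y s ≤ (stringOfCode i).length := by
  induction s with
  | zero => omega
  | succ s ih =>
    rw [stageComplexity_succ]
    rcases Nat.lt_succ_iff_lt_or_eq.1 his with hlt | rfl
    · split_ifs
      · exact (min_le_left _ _).trans (ih hlt)
      · exact ih hlt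
    · rw [if_pos h]
      exact min_le_right _ _

/-- `C` is a code of the decompressor `D`. -/
def IsCodeOf (C : Nat.Partrec.Code) (D : Decompressor) : Prop :=
  ∀ (i : ℕ) (y : List Bool), Encodable.encode y ∈ C.eval i ↔
    ∃ q, Encodable.decode i = some q ∧ y ∈ D q

theorem exists_isCodeOf {D : Decompressor} (hD : Partrec D) : ∃ C, IsCodeOf C D := by
  obtain ⟨C, hC⟩ := Nat.Partrec.Code.exists_code.1 hD
  refine ⟨C, fun i y => ?_⟩
  rw [hC]
  simp [Part.mem_bind_iff]

theorem plainComplexity_le_stageComplexity {D : Decompressor} {C : Nat.Partrec.Code}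
    (hC : IsCodeOf C D) {t L s : ℕ} {y : List Bool} (hL : plainComplexity D y ≤ L) :
    plainComplexity D y ≤ stageComplexity C t L y s := by
  refine le_stageComplexity hL fun i hi => ?_
  obtain ⟨q, hq, hy⟩ := (hC i y).1 (Nat.Partrec.Code.evaln_sound (Option.mem_def.2 hi))
  rw [stringOfCode, hq]
  exact plainComplexity_le hy

theorem eventually_stageComplexity_le {D : Decompressor} (hD : D.IsOptimal)
    {C : Nat.Partrec.Code} (hC : IsCodeOf C D) (L : ℕ) (y : List Bool) :
    ∀ᶠ t in atTop, stageComplexity C t L y t ≤ plainComplexity D y := by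
  obtain ⟨q, hq, hl⟩ := hD.exists_shortest y
  obtain ⟨t₀, ht₀⟩ := Nat.Partrec.Code.evaln_complete.1
    ((hC (Encodable.encode q) y).2 ⟨q, Encodable.encodek q, hq⟩)
  filter_upwards [eventually_ge_atTop t₀] with t ht
  have h1 := Nat.Partrec.Code.evaln_mono ht ht₀
  have h2 := stageComplexity_le (L := L) (Nat.Partrec.Code.evaln_bound h1) h1
  rwa [stringOfCode_encode, hl] at h2

/-! ### Computable expectation over the noise -/

/-- The outcomes of noise with level `A / B` applied to `x`, with their integer weights, which add
up to `B ^ |x|`. -/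
def noiseList (A B : ℕ) (x : List Bool) : List (ℕ × List Bool) :=
  x.foldr (fun b r => r.flatMap fun w => [((B - A) * w.1, b :: w.2), (A * w.1, (!b) :: w.2)])
    [(1, [])]

theorem primrec_noiseList :
    Primrec fun z : (ℕ × ℕ) × List Bool => noiseList z.1.1 z.1.2 z.2 := by
  let β := (((ℕ × ℕ) × List Bool) × (Bool × List (ℕ × List Bool))) × (ℕ × List Bool)
  have hw : Primrec fun z : β => z.2 := Primrec.snd
  have hb : Primrec fun z : β => z.1.2.1 := Primrec.fst.comp (Primrec.snd.comp Primrec.fst)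
  have hAB : Primrec fun z : β => z.1.1.1 := Primrec.fst.comp (Primrec.fst.comp Primrec.fst)
  have hA : Primrec fun z : β => z.1.1.1.1 := Primrec.fst.comp hAB
  have hB : Primrec fun z : β => z.1.1.1.2 := Primrec.snd.comp hAB
  have hw1 : Primrec fun z : β => z.2.1 := Primrec.fst.comp hw
  have hw2 : Primrec fun z : β => z.2.2 := Primrec.snd.comp hw
  have h1 : Primrec fun z : β => ((z.1.1.1.2 - z.1.1.1.1) * z.2.1, z.1.2.1 :: z.2.2) :=
    Primrec.pair (Primrec.nat_mul.comp (Primrec.nat_sub.comp hB hA) hw1)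
      (Primrec.list_cons.comp hb hw2)
  have h2 : Primrec fun z : β => (z.1.1.1.1 * z.2.1, (!z.1.2.1) :: z.2.2) :=
    Primrec.pair (Primrec.nat_mul.comp hA hw1)
      (Primrec.list_cons.comp (Primrec.not.comp hb) hw2)
  have h3 : Primrec fun z : β => [((z.1.1.1.2 - z.1.1.1.1) * z.2.1, z.1.2.1 :: z.2.2),
      (z.1.1.1.1 * z.2.1, (!z.1.2.1) :: z.2.2)] :=
    Primrec.list_cons.comp h1 (Primrec.list_cons.comp h2 (Primrec.const []))
  have h4 : Primrec₂ fun (z : (ℕ × ℕ) × List Bool) (w : Bool × List (ℕ × List Bool)) =>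
      w.2.flatMap fun v => [((z.1.2 - z.1.1) * v.1, w.1 :: v.2), (z.1.1 * v.1, (!w.1) :: v.2)] :=
    Primrec.list_flatMap (f := fun w : ((ℕ × ℕ) × List Bool) × (Bool × List (ℕ × List Bool)) =>
      w.2.2) (Primrec.snd.comp Primrec.snd) h3
  exact Primrec.list_foldr (f := fun z : (ℕ × ℕ) × List Bool => z.2)
    (g := fun _ => [((1 : ℕ), ([] : List Bool))]) Primrec.snd (Primrec.const _) h4

/-- The sum of `w * g y` over the weighted strings `(w, y)` of a list. -/
def weightedSum (l : List (ℕ × List Bool)) (g : List Bool → ℕ) : ℕ :=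
  l.foldr (fun w r => w.1 * g w.2 + r) 0

theorem weightedSum_append (l l' : List (ℕ × List Bool)) (g : List Bool → ℕ) :
    weightedSum (l ++ l') g = weightedSum l g + weightedSum l' g := by
  induction l with
  | nil => simp [weightedSum]
  | cons w l ih =>
    show w.1 * g w.2 + weightedSum (l ++ l') g = w.1 * g w.2 + weightedSum l g + _
    rw [ih, add_assoc]

theorem weightedSum_noiseList_cons (A B : ℕ) (b : Bool) (x : List Bool) (g : List Bool → ℕ) :
    weightedSum (noiseList A B (b :: x)) g =
      (B - A) * weightedSum (noiseList A B x) (fun y => g (b :: y)) +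
        A * weightedSum (noiseList A B x) (fun y => g ((!b) :: y)) := by
  have : noiseList A B (b :: x) = (noiseList A B x).flatMap fun w =>
    [((B - A) * w.1, b :: w.2), (A * w.1, (!b) :: w.2)] := rfl
  rw [this]
  induction noiseList A B x with
  | nil => simp [weightedSum]
  | cons w l ih =>
    rw [List.flatMap_cons, weightedSum_append, ih]
    simp only [weightedSum, List.foldr_cons, List.foldr_nil]
    ring

theorem weightedSum_noiseList {A B : ℕ} (hB : 0 < B) (hAB : A ≤ B) (x : List Bool)
    (g : List Bool → ℕ) :
    (weightedSum (noiseList A B x) g : ℝ) =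
      (B : ℝ) ^ x.length * noiseMean ((A : ℝ) / B) x fun y => g y := by
  induction x generalizing g with
  | nil => simp [noiseList, weightedSum, noiseMean]
  | cons b x ih =>
    rw [weightedSum_noiseList_cons, noiseMean]
    push_cast [hAB]
    rw [ih, ih, List.length_cons, pow_succ]
    have : (B : ℝ) ≠ 0 := by positivity
    field_simp

/-- At stage `t` it is confirmed that `x` has length `n` and that the expected complexity of its
noisy versions is at most `m`, for noise of level `A / n ^ 2`. The parameter `a` encodes `n`, `A`
and `m`. -/
@[irreducible] def confirmsMean (C : Nat.Partrec.Code) (c a : ℕ) (x : List Bool) (t : ℕ) : Bool :=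
  decide (x.length = a.unpair.1) &&
    decide (weightedSum (noiseList a.unpair.2.unpair.1 (x.length * x.length) x)
        (fun y => stageComplexity C t (x.length + c) y t) ≤
      a.unpair.2.unpair.2 *
        weightedSum (noiseList a.unpair.2.unpair.1 (x.length * x.length) x) fun _ => 1)

theorem primrec_weightedSum {α : Type*} [Primcodable α] {f : α → List (ℕ × List Bool)}
    {g : α → List Bool → ℕ} (hf : Primrec f) (hg : Primrec₂ g) :
    Primrec fun z => weightedSum (f z) (g z) := by
  have hw : Primrec fun z : α × ((ℕ × List Bool) × ℕ) => z.2 := Primrec.snd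
  have hs : Primrec fun z : α × ((ℕ × List Bool) × ℕ) => z.2.1.2 :=
    Primrec.snd.comp (Primrec.fst.comp hw)
  have h1 : Primrec fun z : α × ((ℕ × List Bool) × ℕ) => g z.1 z.2.1.2 :=
    hg.comp Primrec.fst hs
  exact Primrec.list_foldr (f := f) (g := fun _ => 0)
    (h := fun z w => w.1.1 * g z w.1.2 + w.2) hf (Primrec.const 0)
    (Primrec.nat_add.comp (Primrec.nat_mul.comp (Primrec.fst.comp (Primrec.fst.comp hw)) h1)
      (Primrec.snd.comp hw))

theorem primrec_confirmsMean (C : Nat.Partrec.Code) (c : ℕ) :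
    Primrec fun z : (ℕ × List Bool) × ℕ => confirmsMean C c z.1.1 z.1.2 z.2 := by
  have ha : Primrec fun z : (ℕ × List Bool) × ℕ => z.1.1.unpair :=
    Primrec.unpair.comp (Primrec.fst.comp Primrec.fst)
  have ha2 : Primrec fun z : (ℕ × List Bool) × ℕ => z.1.1.unpair.2.unpair :=
    Primrec.unpair.comp (Primrec.snd.comp ha)
  have hx : Primrec fun z : (ℕ × List Bool) × ℕ => z.1.2 := Primrec.snd.comp Primrec.fst
  have hn : Primrec fun z : (ℕ × List Bool) × ℕ => z.1.2.length := Primrec.list_length.comp hx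
  have hB : Primrec fun z : (ℕ × List Bool) × ℕ => z.1.2.length * z.1.2.length :=
    Primrec.nat_mul.comp hn hn
  have hl : Primrec fun z : (ℕ × List Bool) × ℕ =>
      noiseList z.1.1.unpair.2.unpair.1 (z.1.2.length * z.1.2.length) z.1.2 :=
    primrec_noiseList.comp (Primrec.pair (Primrec.pair (Primrec.fst.comp ha2) hB) hx)
  have hg : Primrec₂ fun (z : (ℕ × List Bool) × ℕ) (y : List Bool) =>
      stageComplexity C z.2 (z.1.2.length + c) y z.2 :=
    (primrec_stageComplexity C).comp (Primrec.pair (Primrec.pair (Primrec.snd.comp Primrec.fst)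
      (Primrec.nat_add.comp (hn.comp Primrec.fst) (Primrec.const c))) Primrec.snd)
  have h1 := primrec_weightedSum hl hg
  have h2 := primrec_weightedSum hl
    (show Primrec₂ fun (_ : (ℕ × List Bool) × ℕ) (_ : List Bool) => 1 from Primrec.const 1)
  have e1 : PrimrecPred fun z : (ℕ × List Bool) × ℕ => z.1.2.length = z.1.1.unpair.1 :=
    PrimrecRel.comp Primrec.eq hn (Primrec.fst.comp ha)
  have e2 := PrimrecRel.comp Primrec.nat_le h1 (Primrec.nat_mul.comp (Primrec.snd.comp ha2) h2)
  simp only [confirmsMean]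
  exact Primrec.and.comp e1.decide e2.decide

theorem confirmsMean_iff {C : Nat.Partrec.Code} {c n A m : ℕ} {x : List Bool} {t : ℕ}
    (hn : 0 < n) (hA : A ≤ n * n) :
    confirmsMean C c (Nat.pair n (Nat.pair A m)) x t = true ↔ x.length = n ∧
      noiseMean ((A : ℝ) / (n * n : ℕ)) x (fun y => stageComplexity C t (n + c) y t) ≤ m := by
  simp only [confirmsMean, Bool.and_eq_true, decide_eq_true_eq, Nat.unpair_pair]
  refine and_congr_right fun hx => ?_
  subst hx
  have hB : 0 < x.length * x.length := by positivity
  rw [← Nat.cast_le (α := ℝ), Nat.cast_mul, weightedSum_noiseList hB hA,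
    weightedSum_noiseList hB hA, Nat.cast_one, noiseMean_const, mul_one, mul_comm (m : ℝ)]
  exact mul_le_mul_iff_right₀ (by positivity)

theorem exists_confirmsMean_iff {D : Decompressor} (hD : D.IsOptimal)
    {C : Nat.Partrec.Code} (hC : IsCodeOf C D) {c n A m : ℕ}
    (hc : ∀ x, plainComplexity D x ≤ x.length + c) {x : List Bool}
    (hn : 0 < n) (hA : A ≤ n * n) :
    (∃ t, confirmsMean C c (Nat.pair n (Nat.pair A m)) x t = true) ↔ x.length = n ∧
      noiseMean ((A : ℝ) / (n * n : ℕ)) x (fun y => plainComplexity D y) ≤ m := by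
  have hτ : (A : ℝ) / (n * n : ℕ) ∈ Set.Icc (0 : ℝ) 1 :=
    ⟨by positivity, div_le_one_of_le₀ (by exact_mod_cast hA) (by positivity)⟩
  constructor
  · rintro ⟨t, ht⟩
    obtain ⟨hx, h⟩ := (confirmsMean_iff hn hA).1 ht
    refine ⟨hx, (noiseMean_mono hτ fun y hy => ?_).trans h⟩
    exact Nat.cast_le.2 (plainComplexity_le_stageComplexity hC (by rw [← hx, ← hy]; exact hc y))
  · rintro ⟨hx, h⟩
    have hfin : ∀ᶠ t in atTop, ∀ y ∈ {y : List Bool | y.length = n},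
        stageComplexity C t (n + c) y t ≤ plainComplexity D y :=
      (eventually_all_finite (List.finite_length_eq Bool n)).2
        fun y _ => eventually_stageComplexity_le hD hC _ y
    obtain ⟨t, ht⟩ := hfin.exists
    refine ⟨t, (confirmsMean_iff hn hA).2 ⟨hx, (noiseMean_mono hτ fun y hy => ?_).trans h⟩⟩
    exact Nat.cast_le.2 (ht y (hy.trans hx))

/-! ### Encoding of the parameters -/

theorem add_lt_two_pow_size_add (n c : ℕ) : n + c < 2 ^ (n.size + c) := by
  have h1 : n + 1 ≤ 2 ^ n.size := Nat.lt_size_self n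
  have h2 : c + 1 ≤ 2 ^ c := Nat.lt_two_pow_self
  rw [pow_add]
  nlinarith [Nat.mul_le_mul h1 h2]

theorem pair_lt_two_pow {a b k : ℕ} (ha : a < 2 ^ k) (hb : b < 2 ^ k) :
    Nat.pair a b < 2 ^ (2 * k) := by
  refine (Nat.pair_lt_max_add_one_sq a b).trans_le ?_
  rw [mul_comm, pow_mul]
  exact Nat.pow_le_pow_left (max_lt ha hb) 2

theorem exists_ofFn_eq {α : Type*} {n : ℕ} {l : List α} (h : l.length = n) :
    ∃ v : Fin n → α, List.ofFn v = l := by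
  subst h
  exact ⟨l.get, List.ofFn_get l⟩

theorem exists_abs_div_sub_le {τ : ℝ} (hτ : τ ∈ Set.Icc (0 : ℝ) 1) {B : ℕ} (hB : 0 < B) :
    ∃ A : ℕ, A ≤ B ∧ |(A : ℝ) / B - τ| ≤ 1 / B := by
  have hB' : (0 : ℝ) < B := by exact_mod_cast hB
  have h0 : 0 ≤ τ * B := mul_nonneg hτ.1 hB'.le
  refine ⟨⌊τ * B⌋₊, ?_, ?_⟩
  · exact Nat.floor_le_of_le (mul_le_of_le_one_left hB'.le hτ.2)
  · have h1 := Nat.floor_le h0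
    have h2 := Nat.lt_floor_add_one (τ * B)
    rw [show (⌊τ * B⌋₊ : ℝ) / B - τ = (⌊τ * B⌋₊ - τ * B) / B by field_simp, abs_div,
      abs_of_pos hB']
    exact div_le_div_of_nonneg_right (abs_le.2 ⟨by linarith, by linarith⟩) hB'.le

/-! ### Expected complexity after noise -/

/-- Few strings have noisy versions of small expected complexity. -/
theorem card_noiseMean_le {D : Decompressor} (hD : D.IsOptimal) {p τ : ℝ}
    (hp : p ∈ Set.Ioo (0 : ℝ) (1 / 2)) (hτ : τ ∈ Set.Ioo (0 : ℝ) (1 / 2)) {n c : ℕ}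
    (hc : ∀ x, plainComplexity D x ≤ x.length + c) (r : ℝ) :
    ((Finset.univ.filter fun v : Fin n → Bool =>
        noiseMean τ (List.ofFn v) (fun y => plainComplexity D y) ≤ r).card : ℝ) ≤
      Real.exp (gerberSlope p τ * Real.log 2 * r + n * gerberGap p τ +
        gerberSlope p τ * Real.log (n + c + 1)) := by
  set s := gerberSlope p τ with hs
  have hs0 : 0 < s := gerberSlope_pos hp hτ
  have h1 := sum_exp_noiseMean_le hp hτ n fun y => -Real.log 2 * plainComplexity D y
  simp only [noiseMean_mul, ← hs] at h1
  have h2 : Real.log (∑ v : Fin n → Bool,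
      Real.exp (-Real.log 2 * plainComplexity D (List.ofFn v))) ≤ Real.log (n + c + 1) := by
    refine Real.log_le_log (Finset.sum_pos (fun _ _ => Real.exp_pos _) Finset.univ_nonempty) ?_
    have := hD.sum_exp_neg_le (n := n) (M := n + c) fun x hx => by rw [← hx]; exact hc x
    exact_mod_cast this
  have h3 : ((Finset.univ.filter fun v : Fin n → Bool =>
        noiseMean τ (List.ofFn v) (fun y => plainComplexity D y) ≤ r).card : ℝ) *
      Real.exp (-(s * Real.log 2 * r)) ≤ ∑ v : Fin n → Bool,
        Real.exp (s * (-Real.log 2 *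
          noiseMean τ (List.ofFn v) fun y => plainComplexity D y)) := by
    rw [← nsmul_eq_mul, ← Finset.sum_const]
    refine (Finset.sum_le_sum fun v hv => ?_).trans (Finset.sum_le_sum_of_subset_of_nonneg
      (Finset.filter_subset _ _) fun _ _ _ => (Real.exp_pos _).le)
    have := mul_le_mul_of_nonneg_left (Finset.mem_filter.1 hv).2
      (mul_nonneg hs0.le (Real.log_nonneg one_le_two))
    rw [Real.exp_le_exp]
    linarith
  have h4 := (h3.trans h1).trans (Real.exp_le_exp.2
    (add_le_add_right (mul_le_mul_of_nonneg_left h2 hs0.le) (n * gerberGap p τ)))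
  rw [Real.exp_neg, ← div_eq_mul_inv, div_le_iff₀ (Real.exp_pos _), ← Real.exp_add] at h4
  refine h4.trans (le_of_eq ?_)
  congr 1
  ring

/-- The expected complexity after noise is bounded from below in terms of the original complexity.
The strings with a small expected complexity after noise are few, and they can be enumerated once
`τ` is replaced by a fraction with denominator `n ^ 2`, which changes the expectation by `O(1)`. -/
theorem Decompressor.IsOptimal.exists_le_noiseMean {D : Decompressor} (hD : D.IsOptimal) {p τ : ℝ}
    (hp : p ∈ Set.Ioo (0 : ℝ) (1 / 2)) (hτ : τ ∈ Set.Ioo (0 : ℝ) (1 / 2)) :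
    ∃ K : ℝ, ∀ x : List Bool, x ≠ [] → Real.log 2 * plainComplexity D x ≤
      gerberSlope p τ * Real.log 2 * noiseMean τ x (fun y => plainComplexity D y) +
        x.length * gerberGap p τ + K * (x.length.size + 1) := by
  obtain ⟨c, hc⟩ := hD.exists_le_length
  obtain ⟨C, hC⟩ := exists_isCodeOf hD.1
  obtain ⟨c', hc'⟩ := hD.exists_enumeration_le (primrec_confirmsMean C c)
  set s := gerberSlope p τ with hs
  have hs0 : 0 < s := gerberSlope_pos hp hτ
  have hlog0 : 0 < Real.log 2 := Real.log_pos one_lt_two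
  refine ⟨s * Real.log 2 * (2 * c + 3) + s * Real.log 2 * (c + 2) +
    Real.log 2 * (8 * c + 25 + c'), fun x hx => ?_⟩
  set n := x.length with hn
  have hn0 : 0 < n := List.length_pos_iff.2 hx
  have hn1 : (1 : ℝ) ≤ n := by exact_mod_cast hn0
  have hτ' : τ ∈ Set.Icc (0 : ℝ) 1 := ⟨hτ.1.le, by linarith [hτ.2]⟩
  obtain ⟨A, hA, hAτ⟩ := exists_abs_div_sub_le hτ' (B := n * n) (by positivity)
  set σ : ℝ := (A : ℝ) / (n * n : ℕ) with hσ
  have hσ' : σ ∈ Set.Icc (0 : ℝ) 1 :=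
    ⟨by positivity, div_le_one_of_le₀ (by exact_mod_cast hA) (by positivity)⟩
  have hle : ∀ y : List Bool, y.length = n → (plainComplexity D y : ℝ) ≤ n + c := by
    intro y hy
    rw [← hy]
    exact_mod_cast hc y
  have hdiff : ∀ y : List Bool, y.length = n →
      |noiseMean σ y (fun y => plainComplexity D y) -
        noiseMean τ y (fun y => plainComplexity D y)| ≤ c + 1 := by
    intro y hy
    refine (abs_noiseMean_sub_le hσ' hτ' (fun z _ => Nat.cast_nonneg _)
      (fun z hz => hle z (hz.trans hy))).trans ?_
    rw [hy]
    have : (n : ℝ) * ((n + c) * |σ - τ|) ≤ n * ((n + c) * (1 / (n * n : ℕ))) := by gcongr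
    refine this.trans ?_
    push_cast
    rw [show (n : ℝ) * ((n + c) * (1 / (n * n))) = (n + c) / n by field_simp,
      div_le_iff₀ (by linarith)]
    nlinarith [(Nat.cast_nonneg c : (0 : ℝ) ≤ c)]
  set E := noiseMean τ x (fun y => plainComplexity D y) with hE
  have hσ0 : 0 ≤ noiseMean σ x (fun y => plainComplexity D y) :=
    noiseMean_nonneg hσ' fun _ _ => Nat.cast_nonneg _
  set m := ⌈noiseMean σ x (fun y => plainComplexity D y)⌉₊ with hm
  have hm1 : noiseMean σ x (fun y => plainComplexity D y) ≤ m := Nat.le_ceil _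
  have hm2 : (m : ℝ) ≤ E + c + 2 := by
    have := Nat.ceil_lt_add_one hσ0
    have := (abs_le.1 (hdiff x rfl)).2
    linarith
  have hm3 : m ≤ n + c := by
    refine Nat.ceil_le.2 ?_
    push_cast
    exact noiseMean_le hσ' fun y hy => hle y hy
  classical
  set T : Finset (List Bool) := (Finset.univ.filter fun v : Fin n → Bool =>
    noiseMean σ (List.ofFn v) (fun y => plainComplexity D y) ≤ m).image List.ofFn with hT
  have hmem : ∀ y, (∃ t, confirmsMean C c (Nat.pair n (Nat.pair A m)) y t = true) → y ∈ T := by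
    intro y hy
    obtain ⟨hy1, hy2⟩ := (exists_confirmsMean_iff hD hC hc hn0 hA).1 hy
    obtain ⟨v, rfl⟩ := exists_ofFn_eq hy1
    exact Finset.mem_image.2 ⟨v, Finset.mem_filter.2 ⟨Finset.mem_univ _, hy2⟩, rfl⟩
  have hxc : ∃ t, confirmsMean C c (Nat.pair n (Nat.pair A m)) x t = true :=
    (exists_confirmsMean_iff hD hC hc hn0 hA).2 ⟨rfl, hm1⟩
  set R := s * Real.log 2 * (m + c + 1) + n * gerberGap p τ + s * Real.log (n + c + 1) with hR
  have hTR : (T.card : ℝ) ≤ Real.exp R := by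
    have h1 : (T.card : ℝ) ≤ (Finset.univ.filter fun v : Fin n → Bool =>
        noiseMean τ (List.ofFn v) (fun y => plainComplexity D y) ≤ m + c + 1).card := by
      refine Nat.cast_le.2 (Finset.card_image_le.trans (Finset.card_le_card ?_))
      intro v hv
      have h2 := (Finset.mem_filter.1 hv).2
      have h3 := (abs_le.1 (hdiff (List.ofFn v) (by simp))).1
      exact Finset.mem_filter.2 ⟨Finset.mem_univ _, by linarith⟩
    exact h1.trans (card_noiseMean_le hD hp hτ hc _)
  -- The bound `R` on the logarithm of the number of strings is nonnegative, since `x` is one of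
  -- them; otherwise it would not survive rounding up to a natural number.
  have hR0 : 0 ≤ R := by
    rw [← Real.one_le_exp_iff]
    refine le_trans ?_ hTR
    exact_mod_cast Finset.card_pos.2 ⟨x, hmem x hxc⟩
  have hcard : T.card ≤ 2 ^ ⌈R / Real.log 2⌉₊ := by
    rw [← Nat.cast_le (α := ℝ)]
    refine hTR.trans ?_
    push_cast
    rw [← Real.le_log_iff_exp_le (by positivity), Real.log_pow, ← div_le_iff₀ hlog0]
    exact Nat.le_ceil _
  -- The parameter `(n, A, m)` of the enumeration is polynomial in `n`.
  have hk1 : n < 2 ^ (2 * n.size + 2 * c) := by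
    refine (add_lt_two_pow_size_add n c).trans_le' (by omega) |>.trans_le ?_
    exact Nat.pow_le_pow_right two_pos (by omega)
  have hk2 : A < 2 ^ (2 * n.size) := by
    have := Nat.lt_size_self n
    rw [mul_comm, pow_mul, sq]
    exact hA.trans_lt (Nat.mul_lt_mul'' this this)
  have hk3 : m < 2 ^ (n.size + c) := hm3.trans_lt (add_lt_two_pow_size_add n c)
  have hk4 : Nat.pair A m < 2 ^ (2 * (2 * n.size + c)) :=
    pair_lt_two_pow (hk2.trans_le (Nat.pow_le_pow_right two_pos (by omega)))
      (hk3.trans_le (Nat.pow_le_pow_right two_pos (by omega)))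
  have hk5 : Nat.pair n (Nat.pair A m) < 2 ^ (2 * (2 * (2 * n.size + c))) :=
    pair_lt_two_pow (hk1.trans_le (Nat.pow_le_pow_right two_pos (by omega))) hk4
  have hfin := hc' _ _ _ T x hk5 hxc (fun y t ht => hmem y ⟨t, ht⟩) hcard
  have hfin' : (plainComplexity D x : ℝ) ≤
      ⌈R / Real.log 2⌉₊ + 2 * (2 * (2 * (2 * n.size + c))) + c' := by exact_mod_cast hfin
  have hceil := Nat.ceil_lt_add_one (div_nonneg hR0 hlog0.le)
  have h5 : Real.log 2 * plainComplexity D x ≤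
      R + Real.log 2 * (1 + 2 * (2 * (2 * (2 * n.size + c))) + c') := by
    have : Real.log 2 * (R / Real.log 2) = R := by field_simp
    have := mul_le_mul_of_nonneg_left (hfin'.trans (add_le_add_left (add_le_add_left hceil.le _) _))
      hlog0.le
    linarith
  have hlogn : Real.log (n + c + 1) ≤ (n.size + c) * Real.log 2 := by
    have := add_lt_two_pow_size_add n c
    have h6 : (n + c + 1 : ℝ) ≤ 2 ^ (n.size + c) := by exact_mod_cast this
    have := Real.log_le_log (by positivity) h6
    rw [Real.log_pow] at this
    exact_mod_cast this
  have h7 := mul_le_mul_of_nonneg_left hlogn hs0.le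
  have h8 := mul_le_mul_of_nonneg_left hm2 (mul_pos hs0 hlog0).le
  have hsz : (0 : ℝ) ≤ n.size := Nat.cast_nonneg _
  have hcc : (0 : ℝ) ≤ c := Nat.cast_nonneg _
  have hcc' : (0 : ℝ) ≤ c' := Nat.cast_nonneg _
  have h9 : 0 ≤ s * Real.log 2 := (mul_pos hs0 hlog0).le
  refine h5.trans ?_
  have e1 : 0 ≤ s * Real.log 2 * (n.size * (2 * c + 3)) := by positivity
  have e2 : 0 ≤ s * Real.log 2 * (n.size * (c + 1)) := by positivity
  have e3 : 0 ≤ Real.log 2 * (n.size * (8 * c + 9 + c')) := by positivity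
  rw [hR]
  linarith

/-! ### Noise sequences and their prefixes -/

theorem noiseMean_ofFn (τ : ℝ) {n : ℕ} (x : Fin n → Bool) (g : List Bool → ℝ) :
    noiseMean τ (List.ofFn x) g = ∑ v : Fin n → Bool,
      (∏ i, if v i then τ else 1 - τ) * g (List.ofFn fun i => xor (x i) (v i)) := by
  induction n generalizing g with
  | zero => simp [noiseMean]
  | succ n ih =>
    rw [List.ofFn_succ, noiseMean, ih, ih, ← (Fin.consEquiv fun _ : Fin (n + 1) => Bool).sum_comp,
      Fintype.sum_prod_type, Fintype.sum_bool, Finset.mul_sum, Finset.mul_sum, add_comm]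
    simp [Fin.consEquiv, List.ofFn_succ, Fin.prod_univ_succ, mul_assoc]

/-- The law of the noisy prefix is the one described by `noiseMean`. -/
theorem integral_flipBits {Ω : Type*} [MeasurableSpace Ω] {μ : Measure Ω} [IsProbabilityMeasure μ]
    {τ : ℝ} (hτ : 0 ≤ τ) {E : ℕ → Ω → Bool} (hE : IsBitNoise μ τ E) (X : ℕ → Bool) (n : ℕ)
    (g : List Bool → ℝ) :
    ∫ ω, g (firstBits (flipBits X fun i => E i ω) n) ∂μ = noiseMean τ (firstBits X n) g := by
  have hV : Measurable fun ω (i : Fin n) => E i ω :=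
    measurable_pi_lambda _ fun i => hE.measurable i
  have hbit : ∀ (i : ℕ) (b : Bool), μ.real (E i ⁻¹' {b}) = if b then τ else 1 - τ := by
    intro i b
    have ht : μ.real (E i ⁻¹' {true}) = τ := by
      rw [measureReal_def, show E i ⁻¹' {true} = {ω | E i ω = true} from rfl, hE.prob,
        ENNReal.toReal_ofReal hτ]
    cases b with
    | true => simpa using ht
    | false =>
      have : E i ⁻¹' {false} = (E i ⁻¹' {true})ᶜ := by ext ω; simp
      rw [this, probReal_compl_eq_one_sub (hE.measurable i (measurableSet_singleton _)), ht]
      simp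
  rw [firstBits, noiseMean_ofFn]
  have h1 : ∫ ω, g (firstBits (flipBits X fun i => E i ω) n) ∂μ =
      ∫ v, g (List.ofFn fun i : Fin n => xor (X i) (v i)) ∂(μ.map fun ω (i : Fin n) => E i ω) := by
    rw [integral_map hV.aemeasurable]
    · rfl
    · exact (measurable_of_finite _).aestronglyMeasurable
  have : IsProbabilityMeasure (μ.map fun ω (i : Fin n) => E i ω) :=
    Measure.isProbabilityMeasure_map hV.aemeasurable
  rw [h1, integral_fintype .of_finite]
  refine Finset.sum_congr rfl fun v _ => ?_
  rw [smul_eq_mul]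
  congr 1
  rw [map_measureReal_apply hV (measurableSet_singleton _)]
  have h2 : (fun ω (i : Fin n) => E i ω) ⁻¹' {v} = ⋂ i ∈ Finset.univ, E (i : Fin n) ⁻¹' {v i} := by
    ext ω; simp [funext_iff]
  have h3 := (hE.indep.precomp (Fin.val_injective (n := n))).measure_inter_preimage_eq_mul
    Finset.univ (sets := fun i => {v i}) fun i _ => measurableSet_singleton _
  rw [h2, measureReal_def, h3, ENNReal.toReal_prod]
  exact Finset.prod_congr rfl fun i _ => hbit i (v i)

theorem measurable_firstBits_flipBits {Ω : Type*} [MeasurableSpace Ω] {μ : Measure Ω}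
    {τ : ℝ} {E : ℕ → Ω → Bool} (hE : IsBitNoise μ τ E) (X : ℕ → Bool) (n : ℕ)
    (g : List Bool → ℝ) :
    Measurable fun ω => g (firstBits (flipBits X fun i => E i ω) n) := by
  have hV : Measurable fun ω (i : Fin n) => E i ω :=
    measurable_pi_lambda _ fun i => hE.measurable i
  exact (measurable_of_finite fun v : Fin n → Bool =>
    g (List.ofFn fun i : Fin n => xor (X i) (v i))).comp hV

/-- The lower tail bound for a function of a noisy string that satisfies a bounded difference
condition: Chernoff's method. -/
theorem measure_lower_tail_le {Ω : Type*} [MeasurableSpace Ω] {μ : Measure Ω}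
    [IsProbabilityMeasure μ] {τ : ℝ} (hτ : τ ∈ Set.Icc (0 : ℝ) 1) {E : ℕ → Ω → Bool}
    (hE : IsBitNoise μ τ E) (X : ℕ → Bool) {n : ℕ} {g : List Bool → ℝ} {d l r : ℝ} (hl : 0 ≤ l)
    (hld : l * d ≤ 1) (hg : IsFlipLipschitz n d g) :
    μ.real {ω | g (firstBits (flipBits X fun i => E i ω) n) ≤
      noiseMean τ (firstBits X n) g - r} ≤ Real.exp (n * (l * d) ^ 2 - l * r) := by
  have hlen : (firstBits X n).length = n := by simp [firstBits]
  set M := noiseMean τ (firstBits X n) g with hM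
  have h1 := noiseMean_exp_le hτ hl hld (x := firstBits X n) (f := g) (by rwa [hlen])
  rw [hlen, ← hM, ← integral_flipBits hτ.1 hE] at h1
  have hmeas := measurable_firstBits_flipBits hE X n fun y => Real.exp (l * (M - g y))
  have hint : Integrable (fun ω => Real.exp
      (l * (M - g (firstBits (flipBits X fun i => E i ω) n)))) μ := by
    have hfin : (Set.range fun ω => Real.exp
        (l * (M - g (firstBits (flipBits X fun i => E i ω) n)))).Finite :=
      (Set.finite_range fun v : Fin n → Bool => Real.exp (l * (M - g (List.ofFn v)))).subset
        (by rintro _ ⟨ω, rfl⟩; exact ⟨fun i => flipBits X (fun i => E i ω) i, rfl⟩)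
    obtain ⟨B, hB⟩ := hfin.bddAbove
    refine Integrable.of_bound hmeas.aestronglyMeasurable B (ae_of_all _ fun ω => ?_)
    rw [Real.norm_of_nonneg (Real.exp_pos _).le]
    exact hB ⟨ω, rfl⟩
  have h2 := mul_meas_ge_le_integral_of_nonneg (ae_of_all _ fun ω => (Real.exp_pos _).le) hint
    (Real.exp (l * r))
  have h3 : {ω | g (firstBits (flipBits X fun i => E i ω) n) ≤ M - r} ⊆
      {ω | Real.exp (l * r) ≤
        Real.exp (l * (M - g (firstBits (flipBits X fun i => E i ω) n)))} := by
    intro ω hω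
    simp only [Set.mem_ofPred_eq] at hω ⊢
    exact Real.exp_le_exp.2 (mul_le_mul_of_nonneg_left (by linarith) hl)
  have h4 := mul_le_mul_of_nonneg_left (measureReal_mono h3 (μ := μ)) (Real.exp_pos (l * r)).le
  rw [Real.exp_sub, le_div_iff₀ (Real.exp_pos _), mul_comm]
  exact h4.trans (h2.trans h1)

/-! ### Lower bound for the dimension -/

theorem isLittleO_log_natCast_rpow {r : ℝ} (hr : 0 < r) :
    (fun n : ℕ => Real.log n) =o[atTop] fun n : ℕ => (n : ℝ) ^ r :=
  (isLittleO_log_rpow_atTop hr).comp_tendsto tendsto_natCast_atTop_atTop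

theorem isLittleO_const_natCast_rpow {r : ℝ} (hr : 0 < r) (c : ℝ) :
    (fun _ : ℕ => c) =o[atTop] fun n : ℕ => (n : ℝ) ^ r := by
  refine isLittleO_const_left.2 (Or.inr ?_)
  exact tendsto_norm_atTop_atTop.comp
    ((tendsto_rpow_atTop hr).comp tendsto_natCast_atTop_atTop)

theorem isLittleO_size_rpow {r : ℝ} (hr : 0 < r) :
    (fun n : ℕ => (n.size : ℝ)) =o[atTop] fun n : ℕ => (n : ℝ) ^ r := by
  have h1 := ((isLittleO_log_natCast_rpow hr).const_mul_left (1 / Real.log 2)).add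
    (isLittleO_const_natCast_rpow hr 1)
  refine IsBigO.trans_isLittleO (IsBigO.of_bound 1 ?_) h1
  filter_upwards [eventually_gt_atTop 0] with n hn
  have h2 : 2 ^ (n.size - 1) ≤ n := Nat.lt_size.1 (by
    have := Nat.size_pos.2 hn; omega)
  have h3 : (n.size : ℝ) ≤ 1 / Real.log 2 * Real.log n + 1 := by
    have h4 : ((2 : ℝ) ^ (n.size - 1)) ≤ n := by exact_mod_cast h2
    have h5 := Real.log_le_log (by positivity) h4
    rw [Real.log_pow, Nat.cast_sub (Nat.size_pos.2 hn), ← le_div_iff₀ (Real.log_pos one_lt_two)]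
      at h5
    rw [one_div, inv_mul_eq_div]
    push_cast at h5
    linarith
  rw [one_mul, Real.norm_of_nonneg (Nat.cast_nonneg _)]
  exact h3.trans (le_abs_self _)

/-- Almost surely the complexity of the noisy prefixes does not fall below its expectation by a
linear amount infinitely often. -/
theorem Decompressor.IsOptimal.ae_noiseMean_sub_le {D : Decompressor} (hD : D.IsOptimal)
    {Ω : Type*} [MeasurableSpace Ω] {μ : Measure Ω}
    [IsProbabilityMeasure μ] {τ : ℝ} (hτ : τ ∈ Set.Icc (0 : ℝ) 1) {E : ℕ → Ω → Bool}
    (hE : IsBitNoise μ τ E) (X : ℕ → Bool) {ε : ℝ} (hε : 0 < ε) :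
    ∀ᵐ ω ∂μ, ∀ᶠ n : ℕ in atTop,
      noiseMean τ (firstBits X n) (fun y => plainComplexity D y) - ε * n <
        plainComplexity D (firstBits (flipBits X fun i => E i ω) n) := by
  obtain ⟨c, hc⟩ := hD.exists_isFlipLipschitz
  set S : ℕ → Set Ω := fun n =>
    {ω | (plainComplexity D (firstBits (flipBits X fun i => E i ω) n) : ℝ) ≤
      noiseMean τ (firstBits X n) (fun y => plainComplexity D y) - ε * n} with hS
  have hr : (0 : ℝ) < 1 / 4 := by norm_num
  have hd : (fun n : ℕ => 2 * (n.size : ℝ) + c) =o[atTop] fun n : ℕ => (n : ℝ) ^ (1 / 4 : ℝ) :=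
    ((isLittleO_size_rpow hr).const_mul_left 2).add (isLittleO_const_natCast_rpow hr c)
  have hbound : ∀ᶠ n : ℕ in atTop, ‖μ.real (S n)‖ ≤ 1 / (n : ℝ) ^ 2 := by
    filter_upwards [hd.def one_pos, (hd.mul hd).def (half_pos hε),
      (isLittleO_log_natCast_rpow (r := 1 / 2) (by norm_num)).def
        (show 0 < ε / 4 by positivity), eventually_ge_atTop 1] with n h1 h2 h3 hn
    have hn1 : (1 : ℝ) ≤ n := by exact_mod_cast hn
    -- With `q = n ^ (1 / 4)` the parameter of the Chernoff bound is `1 / q ^ 2`; the exponent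
    -- becomes `d ^ 2 - ε q ^ 2`, where `d = O(log n)`.
    set q := (n : ℝ) ^ (1 / 4 : ℝ) with hq
    have hq1 : 1 ≤ q := Real.one_le_rpow hn1 hr.le
    have hq2 : (n : ℝ) ^ (1 / 2 : ℝ) = q * q := by
      rw [hq, ← Real.rpow_add (by linarith)]; norm_num
    have hq4 : (n : ℝ) = (q * q) * (q * q) := by
      rw [← hq2, ← Real.rpow_add (by linarith)]; norm_num
    set d : ℝ := 2 * (n.size : ℝ) + c with hd'
    have hd0 : 0 ≤ d := by positivity
    rw [Real.norm_of_nonneg hd0, Real.norm_of_nonneg (by linarith), one_mul] at h1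
    rw [Real.norm_of_nonneg (by positivity), Real.norm_of_nonneg (by positivity)] at h2
    rw [Real.norm_of_nonneg (Real.log_nonneg hn1), Real.norm_of_nonneg (by positivity), hq2] at h3
    have hqq : 0 < q * q := by positivity
    have h4 := measure_lower_tail_le hτ hE X (n := n) (d := d) (l := 1 / (q * q)) (r := ε * n)
      (g := fun y => plainComplexity D y) (by positivity)
      (by rw [one_div, inv_mul_eq_div, div_le_one hqq]; nlinarith)
      (hc n n.size (Nat.lt_size_self n).le)
    rw [Real.norm_of_nonneg measureReal_nonneg]
    refine h4.trans ?_
    have e1 : (n : ℝ) * (1 / (q * q) * d) ^ 2 - 1 / (q * q) * (ε * n) = d * d - ε * (q * q) := by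
      rw [hq4]; field_simp
    have e2 : 1 / (n : ℝ) ^ 2 = Real.exp (-(2 * Real.log n)) := by
      rw [Real.exp_neg, one_div]
      congr 1
      rw [← Real.exp_log (show 0 < (n : ℝ) by linarith), ← Real.exp_nat_mul, Real.log_exp]
      norm_num
    rw [e1, e2, Real.exp_le_exp]
    linarith
  have hsum : Summable fun n => μ.real (S n) :=
    Summable.of_norm_bounded_eventually_nat (Real.summable_one_div_nat_pow.2 one_lt_two) hbound
  have htop : ∑' n, μ (S n) ≠ ⊤ := by
    have := hsum.tsum_ofReal_ne_top
    rwa [tsum_congr fun n => ofReal_measureReal (measure_ne_top μ (S n))] at this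
  filter_upwards [ae_eventually_notMem htop] with ω hω
  filter_upwards [hω] with n hn
  simpa [hS] using hn

theorem theorem3 (D : Decompressor) (hD : D.IsOptimal)
    (p τ : ℝ) (hp : p ∈ Set.Ioo (0 : ℝ) (1 / 2)) (hτ : τ ∈ Set.Ioo (0 : ℝ) (1 / 2))
    (α β : ℝ) (hα : α = shannonH p) (hβ : β = shannonH (noiseParam p τ))
    (X : ℕ → Bool) (hX : (α : EReal) ≤ effectiveDim D X)
    {Ω : Type*} [MeasurableSpace Ω] (μ : Measure Ω) [IsProbabilityMeasure μ]
    (E : ℕ → Ω → Bool) (hE : IsBitNoise μ τ E) :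
    ∀ᵐ ω ∂μ, (β : EReal) ≤ effectiveDim D (flipBits X fun i => E i ω) := by
  obtain ⟨K, hK⟩ := hD.exists_le_noiseMean hp hτ
  have hs := gerberSlope_pos hp hτ
  set s := gerberSlope p τ with hsdef
  have hlog : 0 < Real.log 2 := Real.log_pos one_lt_two
  have hgap : gerberGap p τ = Real.log 2 * α - s * (Real.log 2 * β) := by
    rw [hα, hβ, shannonH, shannonH, mul_div_cancel₀ _ hlog.ne', mul_div_cancel₀ _ hlog.ne',
      gerberGap]
  -- The expected complexity of the noisy prefixes grows at the rate `β`.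
  have hmean : ∀ ε : ℝ, 0 < ε → ∀ᶠ n : ℕ in atTop,
      (β - 2 * ε) * n ≤ noiseMean τ (firstBits X n) (fun y => plainComplexity D y) := by
    intro ε hε
    have h1 : ((α - s * ε : ℝ) : EReal) < effectiveDim D X :=
      lt_of_lt_of_le (EReal.coe_lt_coe_iff.2 (by linarith [mul_pos hs hε])) hX
    have h2 : (fun n : ℕ => K * ((n.size : ℝ) + 1)) =o[atTop] fun n : ℕ => (n : ℝ) ^ (1 : ℝ) :=
      ((isLittleO_size_rpow one_pos).add (isLittleO_const_natCast_rpow one_pos 1)).const_mul_left K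
    filter_upwards [eventually_lt_of_lt_liminf h1,
      h2.def (show 0 < s * Real.log 2 * ε by positivity), eventually_gt_atTop 0] with n h3 h4 hn
    have hn0 : (0 : ℝ) < n := by exact_mod_cast hn
    rw [EReal.coe_lt_coe_iff, lt_div_iff₀ hn0] at h3
    rw [Real.rpow_one, Real.norm_of_nonneg hn0.le] at h4
    have h5 := (le_abs_self _).trans h4
    have hlen : (firstBits X n).length = n := by simp [firstBits]
    have h6 := hK (firstBits X n) (by rw [← List.length_pos_iff, hlen]; exact hn)
    rw [hlen, hgap] at h6
    have h7 := mul_lt_mul_of_pos_left h3 hlog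
    refine le_of_mul_le_mul_left ?_ (mul_pos hs hlog)
    linarith
  have hae : ∀ᵐ ω ∂μ, ∀ k : ℕ, ∀ᶠ n : ℕ in atTop,
      noiseMean τ (firstBits X n) (fun y => plainComplexity D y) - 1 / ((k : ℝ) + 1) * n <
        plainComplexity D (firstBits (flipBits X fun i => E i ω) n) :=
    ae_all_iff.2 fun k => hD.ae_noiseMean_sub_le ⟨hτ.1.le, by linarith [hτ.2]⟩ hE X
      Nat.one_div_pos_of_nat
  filter_upwards [hae] with ω hω
  refine EReal.ge_of_forall_gt_iff_ge.1 fun z hz => ?_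
  obtain ⟨k, hk⟩ := exists_nat_one_div_lt
    (show 0 < (β - z) / 3 by linarith [EReal.coe_lt_coe_iff.1 hz])
  refine le_liminf_of_le (by isBoundedDefault) ?_
  filter_upwards [hω k, hmean _ Nat.one_div_pos_of_nat, eventually_gt_atTop 0] with n h1 h2 hn
  have hn0 : (0 : ℝ) < n := by exact_mod_cast hn
  rw [EReal.coe_le_coe_iff, le_div_iff₀ hn0]
  have h3 := mul_lt_mul_of_pos_right hk hn0
  generalize 1 / ((k : ℝ) + 1) = ε at h1 h2 h3
  linarith
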